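/- Let $K\ge 1$, let $N_k, M_l, d_j$ ($1\le j,k,l\le K$) be nonnegative integers, and let $\Phi\subseteq\{1,\dots,K\}^2$ be a nonempty set with first and second projections $\Phi_R,\Phi_T\subseteq\{1,\dots,K\}$. Assume that $1\le d_k\le N_k$ for all $k\in\Phi_R$, that $1\le d_l\le M_l$ for all $l\in\Phi_T$, and that $d_k+d_l<N_k+M_l$ for all $(k,l)\in\Phi$. Write $\mathbb G_{a,b}$ for the Grassmannian of $a$-dimensional linear subspaces of $\mathbb C^b$, and let $$\mathcal H=\prod_{(k,l)\in\Phi}\mathbb P(\mathcal M_{N_k\times M_l}(\mathbb C)),\qquad \mathcal S=\Big(\prod_{k\in\Phi_R}\mathbb G_{d_k,N_k}\Big)\times\Big(\prod_{l\in\Phi_T}\mathbb G_{d_l,M_l}\Big),$$ $$\mathcal V=\{(H,U,V)\in\mathcal H\times\mathcal S:\ U_k^TH_{kl}V_l=0\ \text{ for all }(k,l)\in\Phi\},$$ where in the equations $H_{kl}$ stands for any nonzero matrix in its class, and $U_k$ (resp. $V_l$) for any $N_k\times d_k$ (resp. $M_l\times d_l$) matrix whose columns span the given subspace. Then $\mathcal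 V$ is a nonempty compact complex submanifold of the complex manifold $\mathcal H\times\mathcal S$. It is also an algebraic subvariety of $\mathcal H\times\mathcal S$, i.e. the common zero set of polynomials that are homogeneous separately in the entries of each $H_{kl}$ and in the Plücker coordinates of each $U_k$ and of each $V_l$. Its complex dimension is $$\dim_{\mathbb C}\mathcal V=\sum_{(k,l)\in\Phi}(N_kM_l-d_kd_l)+\sum_{k\in\Phi_R}(N_kd_k-d_k^2)+\sum_{l\in\Phi_T}(M_ld_l-d_l^2)-\sharp(\Phi).$$ Consequently $$s:=\sum_{k\in\Phi_R}(N_kd_k-d_k^2)+\sum_{l\in\Phi_T}(M_ld_l-d_l^2)-\sum_{(k,l)\in\Phi}d_kd_l=\dim_{\mathbb C}\mathcal V-\dim_{\mathbb C}\mathcal H.$$ -/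

import Mathlib

open scoped Manifold ContDiff LinearAlgebra.Projectivization

noncomputable section

namespace IA

open Module

/-! ### Grassmannians and projective spaces as complex manifolds -/

/-- The Grassmannian of `a`-dimensional complex linear subspaces of `V`. -/
def Gr (a : ℕ) (V : Type*) [AddCommGroup V] [Module ℂ V] : Type _ :=
  {W : Submodule ℂ V // finrank ℂ W = a}

/-- The model space of the charts: linear maps `ℂ^a → ℂ^c`. -/
abbrev Hom (a c : ℕ) : Type := (Fin a → ℂ) →L[ℂ] (Fin c → ℂ)

section Charts

variable {a c : ℕ} {V : Type*} [AddCommGroup V] [Module ℂ V]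

/-- A linear isomorphism `ℂ^a × ℂ^c ≃ V`; it determines an affine chart of `Gr a V`. -/
abbrev Frame (a c : ℕ) (V : Type*) [AddCommGroup V] [Module ℂ V] : Type _ :=
  ((Fin a → ℂ) × (Fin c → ℂ)) ≃ₗ[ℂ] V

lemma finrank_graph (X : Hom a c) : finrank ℂ (X : (Fin a → ℂ) →ₗ[ℂ] (Fin c → ℂ)).graph = a := by
  rw [LinearMap.graph_eq_range_prod, LinearMap.finrank_range_of_inj]
  · simp
  · intro x y h
    exact congrArg Prod.fst h

/-- The subspace `{g (x, X x) : x ∈ ℂ^a}` of `V`. -/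
def graphPt (g : Frame a c V) (X : Hom a c) : Gr a V :=
  ⟨(X : (Fin a → ℂ) →ₗ[ℂ] (Fin c → ℂ)).graph.map (g : _ →ₗ[ℂ] V), by
    rw [LinearEquiv.finrank_map_eq, finrank_graph]⟩

/-- The transition isomorphism between two frames, as a continuous linear map. -/
def chg (g g' : Frame a c V) :
    ((Fin a → ℂ) × (Fin c → ℂ)) →L[ℂ] ((Fin a → ℂ) × (Fin c → ℂ)) :=
  LinearMap.toContinuousLinearMap (g.trans g'.symm : _ →ₗ[ℂ] _)

lemma chg_apply (g g' : Frame a c V) (x) : chg g g' x = g'.symm (g x) := rfl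

/-- First component of the transition applied to the graph of `X`. -/
def fstT (g g' : Frame a c V) (X : Hom a c) : (Fin a → ℂ) →L[ℂ] (Fin a → ℂ) :=
  (ContinuousLinearMap.fst ℂ _ _ ∘L chg g g') ∘L
    (ContinuousLinearMap.inl ℂ _ _ + ContinuousLinearMap.inr ℂ _ _ ∘L X)

/-- Second component of the transition applied to the graph of `X`. -/
def sndT (g g' : Frame a c V) (X : Hom a c) : Hom a c :=
  (ContinuousLinearMap.snd ℂ _ _ ∘L chg g g') ∘L
    (ContinuousLinearMap.inl ℂ _ _ + ContinuousLinearMap.inr ℂ _ _ ∘L X)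

lemma fstT_apply (g g' : Frame a c V) (X : Hom a c) (x) :
    fstT g g' X x = (g'.symm (g (x, X x))).1 := by
  have : ((x, X x) : (Fin a → ℂ) × (Fin c → ℂ)) = (x, 0) + (0, X x) := by simp
  rw [this, map_add, map_add]
  simp [fstT, chg_apply]

lemma sndT_apply (g g' : Frame a c V) (X : Hom a c) (x) :
    sndT g g' X x = (g'.symm (g (x, X x))).2 := by
  have : ((x, X x) : (Fin a → ℂ) × (Fin c → ℂ)) = (x, 0) + (0, X x) := by simp
  rw [this, map_add, map_add]
  simp [sndT, chg_apply]

lemma contDiff_fstT (g g' : Frame a c V) : ContDiff ℂ ω (fstT g g') := by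
  unfold fstT; fun_prop

lemma contDiff_sndT (g g' : Frame a c V) : ContDiff ℂ ω (sndT g g') := by
  unfold sndT; fun_prop

lemma graphPt_eq_iff (g g' : Frame a c V) (X Y : Hom a c) :
    graphPt g X = graphPt g' Y ↔ sndT g g' X = Y ∘L fstT g g' X := by
  constructor
  · intro h
    ext1 x
    have h1 : g (x, X x) ∈ (graphPt g' Y).1 := by
      rw [← h]
      exact Submodule.mem_map_of_mem (by simp)
    obtain ⟨y, hy, hy'⟩ := h1
    have hy' : g' y = g (x, X x) := hy'
    have hy : y.2 = Y y.1 := by simpa using hy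
    rw [ContinuousLinearMap.comp_apply, sndT_apply, fstT_apply, ← hy']
    simpa using hy
  · intro h
    have hle : (graphPt g X).1 ≤ (graphPt g' Y).1 := by
      rintro _ ⟨y, hy, rfl⟩
      have hy : y.2 = X y.1 := by simpa using hy
      refine ⟨g'.symm (g y), ?_, by simp⟩
      have := DFunLike.congr_fun h y.1
      rw [ContinuousLinearMap.comp_apply, sndT_apply, fstT_apply] at this
      have e : (y.1, X y.1) = y := by rw [← hy]
      rw [e] at this
      simpa using this
    have : FiniteDimensional ℂ V := Module.Finite.equiv g
    exact Subtype.ext (Submodule.eq_of_le_of_finrank_eq hle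
      ((graphPt g X).2.trans (graphPt g' Y).2.symm))

lemma isUnit_fstT (g g' : Frame a c V) (X Y : Hom a c) (h : sndT g g' X = Y ∘L fstT g g' X) :
    IsUnit (fstT g g' X) := by
  have hinj : Function.Injective (fstT g g' X : (Fin a → ℂ) →ₗ[ℂ] (Fin a → ℂ)) := by
    rw [injective_iff_map_eq_zero]
    intro x hx
    have hx : fstT g g' X x = 0 := hx
    have h2 : sndT g g' X x = 0 := by rw [h, ContinuousLinearMap.comp_apply, hx, map_zero]
    rw [fstT_apply] at hx
    rw [sndT_apply] at h2
    have : g'.symm (g (x, X x)) = 0 := Prod.ext hx h2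
    simp only [LinearEquiv.map_eq_zero_iff] at this
    exact congrArg Prod.fst this
  rw [ContinuousLinearMap.isUnit_iff_bijective]
  exact ⟨hinj, LinearMap.injective_iff_surjective.1 hinj⟩

lemma graphPt_eq_of_isUnit (g g' : Frame a c V) (X : Hom a c) (h : IsUnit (fstT g g' X)) :
    graphPt g X = graphPt g' (sndT g g' X ∘L Ring.inverse (fstT g g' X)) := by
  rw [graphPt_eq_iff]
  have : Ring.inverse (fstT g g' X) ∘L fstT g g' X = .id ℂ _ := Ring.inverse_mul_cancel _ h
  rw [ContinuousLinearMap.comp_assoc, this, ContinuousLinearMap.comp_id]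

lemma graphPt_injective (g : Frame a c V) : Function.Injective (graphPt g) := by
  intro X Y h
  rw [graphPt_eq_iff] at h
  ext1 x
  have := DFunLike.congr_fun h x
  rw [ContinuousLinearMap.comp_apply, sndT_apply, fstT_apply] at this
  simpa using this

variable {T : Type*} (f : T ≃ Gr a V)

/-- The affine chart of `T ≃ Gr a V` given by a frame: its domain consists of the subspaces of
the form `{g (x, X x)}`, and it sends such a subspace to the unique such `X`. -/
def chart (g : Frame a c V) : PartialEquiv T (Hom a c) :=
  (Set.InjOn.toPartialEquiv (fun X => f.symm (graphPt g X)) Set.univ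
    (f.symm.injective.comp (graphPt_injective g)).injOn).symm

lemma chart_source (g : Frame a c V) :
    (chart f g).source = Set.range fun X => f.symm (graphPt g X) := by
  simp [chart]

lemma chart_target (g : Frame a c V) : (chart f g).target = Set.univ := by
  simp [chart]

lemma chart_symm (g : Frame a c V) (X) : (chart f g).symm X = f.symm (graphPt g X) := by
  simp [chart]

lemma chart_apply (g : Frame a c V) (X) : chart f g (f.symm (graphPt g X)) = X := by
  rw [← chart_symm]
  exact (chart f g).right_inv (by simp [chart_target])

lemma trans_source (g g' : Frame a c V) :
    ((chart f g).symm.trans (chart f g')).source = {X | IsUnit (fstT g g' X)} := by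
  ext X
  simp only [PartialEquiv.trans_source, PartialEquiv.symm_source, chart_target, chart_source,
    Set.univ_inter, Set.mem_preimage, chart_symm, Set.mem_range, EmbeddingLike.apply_eq_iff_eq,
    Set.mem_ofPred_eq]
  constructor
  · rintro ⟨Y, hY⟩
    exact isUnit_fstT g g' X Y ((graphPt_eq_iff _ _ _ _).1 hY.symm)
  · intro h
    exact ⟨_, (graphPt_eq_of_isUnit g g' X h).symm⟩

lemma contDiffOn_trans (g g' : Frame a c V) :
    ContDiffOn ℂ ω ((chart f g).symm.trans (chart f g'))
      ((chart f g).symm.trans (chart f g')).source := by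
  rw [trans_source]
  have : ContDiffOn ℂ ω (fun X => sndT g g' X ∘L Ring.inverse (fstT g g' X))
      {X | IsUnit (fstT g g' X)} := by
    intro X hX
    refine ContDiffWithinAt.clm_comp (contDiff_sndT g g').contDiffWithinAt ?_
    obtain ⟨u, hu⟩ := hX
    have h1 := contDiffAt_ringInverse (n := ω) ℂ u
    rw [hu] at h1
    exact (h1.comp X (contDiff_fstT g g').contDiffAt).contDiffWithinAt
  refine this.congr fun X hX => ?_
  rw [PartialEquiv.trans_apply, chart_symm, graphPt_eq_of_isUnit g g' X hX, chart_apply]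

end Charts

section Manifold

variable {a : ℕ} {V : Type*} [AddCommGroup V] [Module ℂ V] [FiniteDimensional ℂ V]

lemma exists_frame (W : Gr a V) :
    ∃ g : Frame a (finrank ℂ V - a) V, ∃ X, graphPt g X = W := by
  obtain ⟨C, hC⟩ := W.1.exists_isCompl
  have h1 : finrank ℂ W.1 = a := W.2
  have h2 := Submodule.finrank_add_eq_of_isCompl hC
  let e1 : (Fin a → ℂ) ≃ₗ[ℂ] W.1 := LinearEquiv.ofFinrankEq _ _ (by simp [h1])
  let e2 : (Fin (finrank ℂ V - a) → ℂ) ≃ₗ[ℂ] C := LinearEquiv.ofFinrankEq _ _ (by simp; omega)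
  refine ⟨(e1.prodCongr e2).trans (Submodule.prodEquivOfIsCompl _ _ hC), 0, ?_⟩
  refine Subtype.ext (Submodule.eq_of_le_of_finrank_eq ?_ ((graphPt _ _).2.trans h1.symm))
  rintro _ ⟨y, hy, rfl⟩
  have hy : y.2 = 0 := by simpa using hy
  simp [hy]

variable {T : Type*} (f : T ≃ Gr a V)

/-- The atlas of affine charts on `T ≃ Gr a V`. -/
def core : ChartedSpaceCore (Hom a (finrank ℂ V - a)) T where
  atlas := Set.range (chart f)
  chartAt t := chart f (exists_frame (f t)).choose
  mem_chart_source t := by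
    rw [chart_source]
    obtain ⟨X, hX⟩ := (exists_frame (f t)).choose_spec
    exact ⟨X, by simp [hX]⟩
  chart_mem_atlas t := ⟨_, rfl⟩
  open_source := by
    rintro _ _ ⟨g, rfl⟩ ⟨g', rfl⟩
    rw [trans_source]
    exact Units.isOpen.preimage (contDiff_fstT g g').continuous
  continuousOn_toFun := by
    rintro _ _ ⟨g, rfl⟩ ⟨g', rfl⟩
    exact (contDiffOn_trans f g g').continuousOn

lemma core_isManifold :
    letI := (core f).toTopologicalSpace
    letI := (core f).toChartedSpace
    IsManifold 𝓘(ℂ, Hom a (finrank ℂ V - a)) ω T := by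
  let := (core f).toTopologicalSpace
  let := (core f).toChartedSpace
  apply isManifold_of_contDiffOn
  intro e e' he he'
  obtain ⟨_, ⟨_, rfl⟩, ⟨_, ⟨⟨g, rfl⟩, rfl⟩, rfl⟩⟩ := he
  obtain ⟨_, ⟨_, rfl⟩, ⟨_, ⟨⟨g', rfl⟩, rfl⟩, rfl⟩⟩ := he'
  simp only [modelWithCornersSelf_coe, modelWithCornersSelf_coe_symm, Function.id_comp,
    Function.comp_id, Set.preimage_id, Set.range_id, Set.inter_univ]
  exact contDiffOn_trans f g g'

instance : TopologicalSpace (Gr a V) := (core (Equiv.refl (Gr a V))).toTopologicalSpace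

instance : ChartedSpace (Hom a (finrank ℂ V - a)) (Gr a V) :=
  (core (Equiv.refl (Gr a V))).toChartedSpace

instance : IsManifold 𝓘(ℂ, Hom a (finrank ℂ V - a)) ω (Gr a V) :=
  core_isManifold (Equiv.refl (Gr a V))

/-- Points of the projective space of `V` are the lines in `V`. -/
def projEquiv (V : Type*) [AddCommGroup V] [Module ℂ V] : ℙ ℂ V ≃ Gr 1 V :=
  Projectivization.equivSubmodule ℂ V

instance : TopologicalSpace (ℙ ℂ V) := (core (projEquiv V)).toTopologicalSpace

instance : ChartedSpace (Hom 1 (finrank ℂ V - 1)) (ℙ ℂ V) :=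
  (core (projEquiv V)).toChartedSpace

instance : IsManifold 𝓘(ℂ, Hom 1 (finrank ℂ V - 1)) ω (ℙ ℂ V) :=
  core_isManifold (projEquiv V)

end Manifold

instance isManifold_pi {ι : Type*} [Fintype ι] {E : ι → Type*} [∀ i, NormedAddCommGroup (E i)]
    [∀ i, NormedSpace ℂ (E i)] {H : ι → Type*} [∀ i, TopologicalSpace (H i)]
    (I : ∀ i, ModelWithCorners ℂ (E i) (H i)) (X : ι → Type*) [∀ i, TopologicalSpace (X i)]
    [∀ i, ChartedSpace (H i) (X i)] [∀ i, IsManifold (I i) ω (X i)] :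
    IsManifold (ModelWithCorners.pi I) ω (∀ i, X i) := by
  apply isManifold_of_contDiffOn
  rintro _ _ ⟨e, he, rfl⟩ ⟨e', he', rfl⟩
  rw [contDiffOn_pi]
  intro i
  have h : (e i).symm.trans (e' i) ∈ contDiffGroupoid ω (I i) :=
    HasGroupoid.compatible (he i trivial) (he' i trivial)
  rw [contDiffGroupoid, mem_groupoid_of_pregroupoid] at h
  have hp : ContDiff ℂ ω (fun x : ∀ i, E i => x i) :=
    (ContinuousLinearMap.proj (R := ℂ) (φ := E) i).contDiff
  refine h.1.comp hp.contDiffOn ?_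
  rintro x ⟨hx, ⟨y, rfl⟩⟩
  refine ⟨?_, y i, rfl⟩
  have h1 := hx.1 i trivial
  have h2 := hx.2 i trivial
  exact ⟨h1, h2⟩

/-- A subset `Z` of the complex manifold `X` is a complex submanifold of complex dimension `n`:
around each of its points there is a holomorphic chart of `X` in which `Z` is a piece of an
`n`-dimensional complex linear subspace. -/
def IsComplexSubmanifold {E : Type*} [NormedAddCommGroup E] [NormedSpace ℂ E]
    {H : Type*} [TopologicalSpace H] (I : ModelWithCorners ℂ E H)
    {X : Type*} [TopologicalSpace X] [ChartedSpace H X] (n : ℕ) (Z : Set X) : Prop :=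
  ∀ z ∈ Z, ∃ φ ∈ IsManifold.maximalAtlas I ω X, z ∈ φ.source ∧
    ∃ F : Submodule ℂ E, finrank ℂ F = n ∧
      φ.extend I '' (φ.source ∩ Z) = (φ.extend I).target ∩ F

/-! ### The alignment problem -/

/-- The data of an interference channel: `K` users, `N k` antennas at receiver `k`, `M l` antennas
at transmitter `l`, `d j` streams of user `j`, and the set `Φ` of interfering links. -/
structure Channel where
  K : ℕ
  N : Fin K → ℕ
  M : Fin K → ℕ
  d : Fin K → ℕ
  Φ : Finset (Fin K × Fin K)

namespace Channel

variable (P : Channel)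

/-- Receivers suffering interference. -/
def ΦR : Finset (Fin P.K) := P.Φ.image Prod.fst

/-- Transmitters provoking interference. -/
def ΦT : Finset (Fin P.K) := P.Φ.image Prod.snd

/-- The receiver of a link. -/
def rx (p : P.Φ) : P.ΦR := ⟨p.1.1, Finset.mem_image_of_mem _ p.2⟩

/-- The transmitter of a link. -/
def tx (p : P.Φ) : P.ΦT := ⟨p.1.2, Finset.mem_image_of_mem _ p.2⟩

/-- Channel matrices of a link. -/
abbrev Mat (p : P.Φ) : Type := Matrix (Fin (P.N (P.rx p))) (Fin (P.M (P.tx p))) ℂ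

/-- The input space `ℋ`. -/
abbrev Inp : Type := (p : P.Φ) → ℙ ℂ (P.Mat p)

/-- The decoders. -/
abbrev Dec : Type := (k : P.ΦR) → Gr (P.d k) (Fin (P.N k) → ℂ)

/-- The precoders. -/
abbrev Pre : Type := (l : P.ΦT) → Gr (P.d l) (Fin (P.M l) → ℂ)

/-- The output space `𝒮`. -/
abbrev Out : Type := P.Dec × P.Pre

/-- The complex manifold structure of `ℋ`. -/
abbrev modelInp := ModelWithCorners.pi fun p : P.Φ => 𝓘(ℂ, Hom 1 (finrank ℂ (P.Mat p) - 1))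

/-- The complex manifold structure of the space of decoders. -/
abbrev modelDec := ModelWithCorners.pi fun k : P.ΦR =>
  𝓘(ℂ, Hom (P.d k) (finrank ℂ (Fin (P.N k) → ℂ) - P.d k))

/-- The complex manifold structure of the space of precoders. -/
abbrev modelPre := ModelWithCorners.pi fun l : P.ΦT =>
  𝓘(ℂ, Hom (P.d l) (finrank ℂ (Fin (P.M l) → ℂ) - P.d l))

/-- The complex manifold structure of `ℋ × 𝒮`. -/
abbrev model := P.modelInp.prod (P.modelDec.prod P.modelPre)

/-- The complex dimension of `ℋ`, that is, of the vector space on which it is modelled. -/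
def dimInp : ℕ := finrank ℂ ((p : P.Φ) → Hom 1 (finrank ℂ (P.Mat p) - 1))

/-- Affine data: channel, decoder and precoder matrices. -/
structure Affine where
  H : (p : P.Φ) → P.Mat p
  U : (k : P.ΦR) → Matrix (Fin (P.N k)) (Fin (P.d k)) ℂ
  V : (l : P.ΦT) → Matrix (Fin (P.M l)) (Fin (P.d l)) ℂ

variable {P}

/-- The matrices `t` represent `z ∈ ℋ × 𝒮`: each `H_kl` is a nonzero matrix in its projective
class, and the column spaces of `U_k` and `V_l` are the given subspaces. -/
def Affine.Represents (t : P.Affine) (z : P.Inp × P.Out) : Prop :=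
  (∀ p, ∃ h : t.H p ≠ 0, Projectivization.mk ℂ (t.H p) h = z.1 p) ∧
  (∀ k, LinearMap.range (t.U k).mulVecLin = (z.2.1 k).1) ∧
  (∀ l, LinearMap.range (t.V l).mulVecLin = (z.2.2 l).1)

/-- The alignment equations `U_kᵀ H_kl V_l = 0` for all links `(k, l) ∈ Φ`. -/
def Affine.Aligned (t : P.Affine) : Prop :=
  ∀ p, (t.U (P.rx p)).transpose * t.H p * t.V (P.tx p) = 0

variable (P)

/-- The solution variety `𝒱 ⊆ ℋ × 𝒮`. The alignment equations do not depend on the chosen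
representatives. -/
def solutionVariety : Set (P.Inp × P.Out) :=
  {z | ∀ t : P.Affine, t.Represents z → t.Aligned}

/-- The projective spaces in which `ℋ × 𝒮` is embedded: one for each factor, using the Plücker
embedding for the Grassmannians. -/
abbrev Factor : Type := P.Φ ⊕ P.ΦR ⊕ P.ΦT

/-- Index set of the homogeneous coordinates of a factor: matrix entries for `ℙ(M_{N×M}(ℂ))`,
Plücker coordinates (indexed by the choices of `d` rows) for the Grassmannians. -/
def CoordIdx : P.Factor → Type
  | .inl p => Fin (P.N (P.rx p)) × Fin (P.M (P.tx p))
  | .inr (.inl k) => Fin (P.d k) ↪o Fin (P.N k)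
  | .inr (.inr l) => Fin (P.d l) ↪o Fin (P.M l)

/-- The homogeneous coordinates (matrix entries and maximal minors) of given representatives. -/
def Affine.coord {P : Channel} (t : P.Affine) : (Σ i, P.CoordIdx i) → ℂ
  | ⟨.inl p, ij⟩ => t.H p ij.1 ij.2
  | ⟨.inr (.inl k), (r : Fin (P.d k) ↪o Fin (P.N k))⟩ => ((t.U k).submatrix r id).det
  | ⟨.inr (.inr l), (r : Fin (P.d l) ↪o Fin (P.M l))⟩ => ((t.V l).submatrix r id).det

/-- `p` is homogeneous separately in the coordinates of each projective factor. -/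
def IsMultihomogeneous (p : MvPolynomial (Σ i, P.CoordIdx i) ℂ) : Prop :=
  ∃ e : P.Factor → ℕ, p.IsWeightedHomogeneous
    (fun c : Σ i, P.CoordIdx i => (Pi.single c.1 1 : P.Factor → ℕ)) e

/-- Algebraic subvarieties (Zariski closed subsets) of `ℋ × 𝒮`: the common zero sets of families
of multihomogeneous polynomials in the homogeneous coordinates. -/
def IsAlgebraicSubvariety (Z : Set (P.Inp × P.Out)) : Prop :=
  ∃ S : Set (MvPolynomial (Σ i, P.CoordIdx i) ℂ), (∀ p ∈ S, P.IsMultihomogeneous p) ∧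
    ∀ z (t : P.Affine), t.Represents z → (z ∈ Z ↔ ∀ p ∈ S, MvPolynomial.eval t.coord p = 0)

/-- The number `s` of unknowns minus the number of equations of the alignment problem. -/
def s : ℤ :=
  (∑ k ∈ P.ΦR, ((P.N k : ℤ) * P.d k - (P.d k : ℤ) ^ 2))
    + (∑ l ∈ P.ΦT, ((P.M l : ℤ) * P.d l - (P.d l : ℤ) ^ 2))
    - ∑ p ∈ P.Φ, (P.d p.1 : ℤ) * P.d p.2

end Channel

end IA

end

/-!
The points of `ℋ × 𝒮` that solve the alignment problem are described without coordinates
(`Channel.mem_solutionVariety_iff`): every line of channel matrices `H_kl` has to lie in the linear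
space `annih U_k V_l` of matrices whose bilinear form vanishes on `U_k × V_l`. This space has
dimension `N_k M_l - d_k d_l` (`finrank_annih`), which is positive under the hypotheses. Hence the
projection of the solution variety to `𝒮` is a bundle of nonempty products of projective spaces,
which explains nonemptiness and the dimension.

Submanifold. The shears of `ℂ^N` in the coordinates of an affine chart of the Grassmannian move
the centre of the chart to any other of its points. Acting by pairs of them on matrices
(`pullback`) carries `annih U V` to `annih U₀ V₀`, holomorphically in `(U, V)`. So if, over the
point `(U, V)`, the projective space of matrices is given the affine chart of the moved frame
(`movingFrame`), then the solution variety has equations that are linear and do not involve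
`(U, V)`. Passing from fixed to moving frames is a biholomorphism between open sets of the model
space (`changeFrames`), so that this is a chart of the maximal atlas (`Frames.straightChart`).

Compactness. The solution variety is the image of a compact set of normalized representatives:
orthonormal bases of the subspaces and matrices with largest entry of modulus one. Taking the
column space is continuous for the topology defined by the affine charts
(`continuous_of_range_eq`).

Algebraicity. If `U_r` is a square submatrix of `U` with as many rows as `U` has columns, the
entries of `U * adj(U_r)` are, up to sign, zero or maximal minors of `U`, and `adj(U_r)` is
invertible for a suitable choice of the rows. So `Uᵀ H V = 0` says that all the matrices
`(U * adj(U_r))ᵀ H (V * adj(V_r'))` vanish (`aligned_iff_forall_minors`), and their entries are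
linear separately in the entries of `H` and in the Plücker coordinates of `U` and of `V`.
-/

noncomputable section

namespace IA

open Module

/-! ### Frames and affine charts -/

section Frames

variable {a c : ℕ} {V : Type*} [AddCommGroup V] [Module ℂ V]

lemma mem_graphPt {g : Frame a c V} {X : Hom a c} {v : V} :
    v ∈ (graphPt g X).1 ↔ ∃ x, g (x, X x) = v := by
  constructor
  · rintro ⟨y, hy, rfl⟩
    have hy : y.2 = X y.1 := by simpa using hy
    exact ⟨y.1, by rw [← hy]; rfl⟩
  · rintro ⟨x, rfl⟩
    exact Submodule.mem_map_of_mem (by simp)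

/-- The unipotent automorphism `(x, y) ↦ (x, y + X x)`, which carries the graph of `0` to the
graph of `X`. -/
def shear (X : Hom a c) :
    ((Fin a → ℂ) × (Fin c → ℂ)) ≃ₗ[ℂ] ((Fin a → ℂ) × (Fin c → ℂ)) where
  toFun p := (p.1, p.2 + X p.1)
  invFun p := (p.1, p.2 - X p.1)
  map_add' p q := Prod.ext rfl (by simp only [Prod.fst_add, Prod.snd_add, map_add]; abel)
  map_smul' r p := Prod.ext rfl (by simp)
  left_inv p := by simp
  right_inv p := by simp

lemma shear_apply (X : Hom a c) (p) : shear X p = (p.1, p.2 + X p.1) := rfl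

lemma shear_symm (X : Hom a c) : (shear X).symm = shear (-X) := by
  ext p : 1
  change (p.1, p.2 - X p.1) = (p.1, p.2 + (-X) p.1)
  simp [sub_eq_add_neg]

lemma shear_zero : shear (0 : Hom a c) = LinearEquiv.refl ℂ _ := by
  ext p : 1
  simp [shear_apply]

/-- Every point of the Grassmannian is the centre of an affine chart. -/
lemma exists_frame_graphPt_zero [FiniteDimensional ℂ V] (W : Gr a V) :
    ∃ g : Frame a (finrank ℂ V - a) V, graphPt g 0 = W := by
  obtain ⟨g, X, rfl⟩ := exists_frame W
  refine ⟨(shear X).trans g, Subtype.ext (Submodule.ext fun v => ?_)⟩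
  simp [mem_graphPt, shear_apply]

/-- Coordinates, with respect to the frame `g'`, of the subspace with coordinates `X` with respect
to the frame `g`. -/
def transit (g g' : Frame a c V) (X : Hom a c) : Hom a c :=
  sndT g g' X ∘L Ring.inverse (fstT g g' X)

lemma graphPt_transit {g g' : Frame a c V} {X : Hom a c} (h : IsUnit (fstT g g' X)) :
    graphPt g' (transit g g' X) = graphPt g X :=
  (graphPt_eq_of_isUnit g g' X h).symm

lemma isUnit_fstT_transit {g g' : Frame a c V} {X : Hom a c} (h : IsUnit (fstT g g' X)) :
    IsUnit (fstT g' g (transit g g' X)) :=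
  isUnit_fstT _ _ _ X ((graphPt_eq_iff _ _ _ _).1 (graphPt_transit h))

lemma transit_transit {g g' : Frame a c V} {X : Hom a c} (h : IsUnit (fstT g g' X)) :
    transit g' g (transit g g' X) = X :=
  graphPt_injective g <| by
    rw [graphPt_transit (isUnit_fstT_transit h), graphPt_transit h]

lemma isUnit_fstT_self (g : Frame a c V) (X : Hom a c) : IsUnit (fstT g g X) :=
  isUnit_fstT _ _ _ X ((graphPt_eq_iff _ _ _ _).1 rfl)

end Frames

/-! ### Holomorphic families of frames -/

section Families

variable {ι : Type*} {a c : ι → ℕ} {V : ι → Type*} [∀ i, AddCommGroup (V i)]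
  [∀ i, Module ℂ (V i)] {S : Type*}

/-- Passage from coordinates with respect to the frames `G i s` to coordinates with respect to the
frames `G' i s`, over each `s : S`. It is meaningful on `changeFramesDomain G G'` only, since
`transit` uses the inverse of the first component of the transition. -/
def changeFramesFun (G G' : ∀ i, S → Frame (a i) (c i) (V i)) (x : (∀ i, Hom (a i) (c i)) × S) :
    (∀ i, Hom (a i) (c i)) × S :=
  (fun i => transit (G i x.2) (G' i x.2) (x.1 i), x.2)

/-- The points at which every transition from `G` to `G'` is defined. -/
def changeFramesDomain (G G' : ∀ i, S → Frame (a i) (c i) (V i)) :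
    Set ((∀ i, Hom (a i) (c i)) × S) :=
  {x | ∀ i, IsUnit (fstT (G i x.2) (G' i x.2) (x.1 i))}

variable {G G' : ∀ i, S → Frame (a i) (c i) (V i)}

lemma mapsTo_changeFramesFun :
    Set.MapsTo (changeFramesFun G G') (changeFramesDomain G G') (changeFramesDomain G' G) :=
  fun _ hx i => isUnit_fstT_transit (hx i)

lemma leftInvOn_changeFramesFun :
    Set.LeftInvOn (changeFramesFun G' G) (changeFramesFun G G') (changeFramesDomain G G') :=
  fun _ hx => Prod.ext (funext fun i => transit_transit (hx i)) rfl

variable [Fintype ι] [NormedAddCommGroup S] [NormedSpace ℂ S]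

lemma contDiff_fstT_family (h : ∀ i, ContDiff ℂ ω fun s => chg (G i s) (G' i s)) (i : ι) :
    ContDiff ℂ ω fun x : (∀ i, Hom (a i) (c i)) × S => fstT (G i x.2) (G' i x.2) (x.1 i) := by
  have h1 : ContDiff ℂ ω fun x : (∀ i, Hom (a i) (c i)) × S => chg (G i x.2) (G' i x.2) :=
    (h i).comp contDiff_snd
  have h2 : ContDiff ℂ ω fun x : (∀ i, Hom (a i) (c i)) × S => x.1 i :=
    (ContinuousLinearMap.proj (R := ℂ) (φ := fun i => Hom (a i) (c i)) i).contDiff.comp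
      contDiff_fst
  unfold fstT
  fun_prop

lemma contDiff_sndT_family (h : ∀ i, ContDiff ℂ ω fun s => chg (G i s) (G' i s)) (i : ι) :
    ContDiff ℂ ω fun x : (∀ i, Hom (a i) (c i)) × S => sndT (G i x.2) (G' i x.2) (x.1 i) := by
  have h1 : ContDiff ℂ ω fun x : (∀ i, Hom (a i) (c i)) × S => chg (G i x.2) (G' i x.2) :=
    (h i).comp contDiff_snd
  have h2 : ContDiff ℂ ω fun x : (∀ i, Hom (a i) (c i)) × S => x.1 i :=
    (ContinuousLinearMap.proj (R := ℂ) (φ := fun i => Hom (a i) (c i)) i).contDiff.comp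
      contDiff_fst
  unfold sndT
  fun_prop

lemma contDiffOn_changeFramesFun (h : ∀ i, ContDiff ℂ ω fun s => chg (G i s) (G' i s)) :
    ContDiffOn ℂ ω (changeFramesFun G G') (changeFramesDomain G G') := by
  refine ContDiffOn.prodMk (contDiffOn_pi.2 fun i x hx => ?_) contDiff_snd.contDiffOn
  refine ContDiffWithinAt.clm_comp (contDiff_sndT_family h i).contDiffWithinAt ?_
  obtain ⟨u, hu⟩ := hx i
  have h1 := contDiffAt_ringInverse (n := ω) ℂ u
  rw [hu] at h1
  exact (h1.comp x (contDiff_fstT_family h i).contDiffAt).contDiffWithinAt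

lemma isOpen_changeFramesDomain (h : ∀ i, ContDiff ℂ ω fun s => chg (G i s) (G' i s)) :
    IsOpen (changeFramesDomain G G') := by
  have : changeFramesDomain G G' = ⋂ i, {x | IsUnit (fstT (G i x.2) (G' i x.2) (x.1 i))} := by
    ext x
    simp [changeFramesDomain]
  rw [this]
  exact isOpen_iInter_of_finite fun i =>
    Units.isOpen.preimage (contDiff_fstT_family h i).continuous

/-- The local biholomorphism of `(∏ i, Hom (a i) (c i)) × S` that re-expresses a family of
subspaces, given over the parameter `s : S` by coordinates with respect to the frames `G i s`,
in coordinates with respect to the frames `G' i s`. -/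
def changeFrames (h : ∀ i, ContDiff ℂ ω fun s => chg (G i s) (G' i s))
    (h' : ∀ i, ContDiff ℂ ω fun s => chg (G' i s) (G i s)) :
    OpenPartialHomeomorph ((∀ i, Hom (a i) (c i)) × S) ((∀ i, Hom (a i) (c i)) × S) where
  toFun := changeFramesFun G G'
  invFun := changeFramesFun G' G
  source := changeFramesDomain G G'
  target := changeFramesDomain G' G
  map_source' := mapsTo_changeFramesFun
  map_target' := mapsTo_changeFramesFun
  left_inv' := leftInvOn_changeFramesFun
  right_inv' := leftInvOn_changeFramesFun
  open_source := isOpen_changeFramesDomain h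
  open_target := isOpen_changeFramesDomain h'
  continuousOn_toFun := (contDiffOn_changeFramesFun h).continuousOn
  continuousOn_invFun := (contDiffOn_changeFramesFun h').continuousOn

end Families

/-! ### The topology of the Grassmannian -/

section Charts

variable {a : ℕ} {V : Type*} [AddCommGroup V] [Module ℂ V] [FiniteDimensional ℂ V]

/-- The affine chart of `T ≃ Gr a V` as an open partial homeomorphism. -/
def affineChart {T : Type*} (f : T ≃ Gr a V) (g : Frame a (finrank ℂ V - a) V) :
    @OpenPartialHomeomorph T (Hom a (finrank ℂ V - a)) (core f).toTopologicalSpace _ :=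
  (core f).openPartialHomeomorph (chart f g) ⟨g, rfl⟩

/-- The affine chart of the Grassmannian given by a frame. -/
def grChart (g : Frame a (finrank ℂ V - a) V) :
    OpenPartialHomeomorph (Gr a V) (Hom a (finrank ℂ V - a)) :=
  affineChart (Equiv.refl _) g

/-- The affine chart of the projective space given by a frame. -/
def projChart (g : Frame 1 (finrank ℂ V - 1) V) :
    OpenPartialHomeomorph (ℙ ℂ V) (Hom 1 (finrank ℂ V - 1)) :=
  affineChart (projEquiv V) g

lemma grChart_mem_atlas (g : Frame a (finrank ℂ V - a) V) :
    grChart g ∈ atlas (Hom a (finrank ℂ V - a)) (Gr a V) :=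
  Set.mem_iUnion₂.2 ⟨chart (Equiv.refl _) g, ⟨g, rfl⟩, rfl⟩

lemma projChart_mem_atlas (g : Frame 1 (finrank ℂ V - 1) V) :
    projChart g ∈ atlas (Hom 1 (finrank ℂ V - 1)) (ℙ ℂ V) :=
  Set.mem_iUnion₂.2 ⟨chart (projEquiv V) g, ⟨g, rfl⟩, rfl⟩

lemma mem_grChart_target (g : Frame a (finrank ℂ V - a) V) (X) : X ∈ (grChart g).target := by
  change X ∈ (chart _ g).target
  rw [chart_target]
  trivial

lemma mem_projChart_target (g : Frame 1 (finrank ℂ V - 1) V) (X) : X ∈ (projChart g).target := by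
  change X ∈ (chart _ g).target
  rw [chart_target]
  trivial

lemma grChart_symm_apply (g : Frame a (finrank ℂ V - a) V) (X) :
    (grChart g).symm X = graphPt g X :=
  chart_symm (Equiv.refl _) g X

lemma projChart_symm_apply (g : Frame 1 (finrank ℂ V - 1) V) (X) :
    (projChart g).symm X = (projEquiv V).symm (graphPt g X) :=
  chart_symm (projEquiv V) g X

/-- A map to `T ≃ Gr a V` is continuous if the subspaces it takes as values are the ranges of
linear maps that depend continuously on the argument. -/
lemma continuous_of_range_eq {T : Type*} (f : T ≃ Gr a V) {Y : Type*} [TopologicalSpace Y]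
    (r : Y → T) (A : Y → (Fin a → ℂ) →ₗ[ℂ] V)
    (hA : ∀ x (l : V →ₗ[ℂ] ℂ), Continuous fun y => l (A y x))
    (hr : ∀ y, LinearMap.range (A y) = (f (r y)).1) :
    @Continuous Y T _ (core f).toTopologicalSpace r := by
  let := (core f).toTopologicalSpace
  rw [continuous_iff_continuousAt]
  intro y₀
  obtain ⟨g, hg⟩ := exists_frame_graphPt_zero (f (r y₀))
  -- In the frame centred at the value at `y₀`, the subspace at `y` consists of the pairs
  -- `(B y x, C y x)`, so that its coordinate is `C y ∘ (B y)⁻¹` as long as `B y` is invertible.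
  let B : Y → (Fin a → ℂ) →L[ℂ] (Fin a → ℂ) := fun y =>
    LinearMap.toContinuousLinearMap
      (LinearMap.fst ℂ _ (Fin (finrank ℂ V - a) → ℂ) ∘ₗ g.symm.toLinearMap ∘ₗ A y)
  let C : Y → Hom a (finrank ℂ V - a) := fun y =>
    LinearMap.toContinuousLinearMap (LinearMap.snd ℂ (Fin a → ℂ) _ ∘ₗ g.symm.toLinearMap ∘ₗ A y)
  have hgA : ∀ y x, g (B y x, C y x) = A y x := fun y x => g.apply_symm_apply (A y x)
  have hB : Continuous B := by
    refine continuous_clm_apply.2 fun x => continuous_pi fun j => ?_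
    exact hA x (LinearMap.proj j ∘ₗ LinearMap.fst ℂ _ (Fin (finrank ℂ V - a) → ℂ) ∘ₗ
      g.symm.toLinearMap)
  have hC : Continuous C := by
    refine continuous_clm_apply.2 fun x => continuous_pi fun j => ?_
    exact hA x (LinearMap.proj j ∘ₗ LinearMap.snd ℂ (Fin a → ℂ) _ ∘ₗ g.symm.toLinearMap)
  have hinj : ∀ y, Function.Injective (A y) := fun y => by
    rw [← LinearMap.ker_eq_bot, ← Submodule.finrank_eq_zero]
    have h1 := LinearMap.finrank_range_add_finrank_ker (A y)
    have h2 := (f (r y)).2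
    rw [← hr y] at h2
    simp only [finrank_fintype_fun_eq_card, Fintype.card_fin] at h1
    omega
  have hB₀ : IsUnit (B y₀) := by
    rw [ContinuousLinearMap.isUnit_iff_bijective]
    have : Function.Injective (B y₀ : (Fin a → ℂ) →ₗ[ℂ] (Fin a → ℂ)) := by
      rw [injective_iff_map_eq_zero]
      intro x hx
      have hx : B y₀ x = 0 := hx
      have h1 : A y₀ x ∈ (graphPt g 0).1 := by
        rw [hg, ← hr]
        exact LinearMap.mem_range_self _ x
      obtain ⟨u, hu⟩ := mem_graphPt.1 h1
      rw [← hgA y₀ x, hx, g.injective.eq_iff, Prod.mk.injEq] at hu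
      apply hinj y₀
      have hC₀ : C y₀ x = 0 := by rw [← hu.2]; simp
      rw [map_zero, ← hgA, hx, hC₀, Prod.mk_zero_zero, map_zero]
    exact ⟨this, LinearMap.injective_iff_surjective.1 this⟩
  have hev : r =ᶠ[nhds y₀] fun y => (affineChart f g).symm (C y ∘L Ring.inverse (B y)) := by
    filter_upwards [(Units.isOpen.preimage hB).mem_nhds hB₀] with y hy
    have hy : IsUnit (B y) := hy
    have h1 : (affineChart f g).symm (C y ∘L Ring.inverse (B y)) =
        f.symm (graphPt g (C y ∘L Ring.inverse (B y))) := chart_symm f g _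
    rw [h1, Equiv.eq_symm_apply]
    have := FiniteDimensional.finiteDimensional_submodule (f (r y)).1
    refine Subtype.ext (Submodule.eq_of_le_of_finrank_eq ?_
      ((f (r y)).2.trans (graphPt g _).2.symm))
    rw [← hr y]
    rintro _ ⟨x, rfl⟩
    rw [mem_graphPt]
    refine ⟨B y x, ?_⟩
    have h2 : Ring.inverse (B y) (B y x) = x :=
      DFunLike.congr_fun (Ring.inverse_mul_cancel _ hy) x
    rw [ContinuousLinearMap.comp_apply, h2, hgA]
  refine ContinuousAt.congr ?_ hev.symm
  have hinv : ContinuousAt (fun y => Ring.inverse (B y)) y₀ := by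
    obtain ⟨u, hu⟩ := hB₀
    have h1 := NormedRing.inverse_continuousAt u
    rw [hu] at h1
    exact ContinuousAt.comp (f := B) h1 hB.continuousAt
  have h3 : ContinuousAt (fun y => C y ∘L Ring.inverse (B y)) y₀ :=
    hC.continuousAt.clm_comp hinv
  refine ContinuousAt.comp (g := (affineChart f g).symm) ?_ h3
  refine (affineChart f g).symm.continuousAt ?_
  change _ ∈ (chart f g).target
  rw [chart_target]
  trivial

end Charts

/-! ### Matrices annihilating a pair of subspaces -/

section Matrices

open Matrix

variable {m n : ℕ}

/-- The matrices whose associated bilinear form vanishes on `A × B`. -/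
def annih (A : Submodule ℂ (Fin m → ℂ)) (B : Submodule ℂ (Fin n → ℂ)) :
    Submodule ℂ (Matrix (Fin m) (Fin n) ℂ) where
  carrier := {H | ∀ u ∈ A, ∀ v ∈ B, u ⬝ᵥ H *ᵥ v = 0}
  add_mem' h h' u hu v hv := by
    rw [add_mulVec, dotProduct_add, h u hu v hv, h' u hu v hv, add_zero]
  zero_mem' u _ v _ := by rw [zero_mulVec, dotProduct_zero]
  smul_mem' r H h u hu v hv := by
    rw [smul_mulVec, dotProduct_smul, h u hu v hv, smul_zero]

lemma mem_annih {A : Submodule ℂ (Fin m → ℂ)} {B : Submodule ℂ (Fin n → ℂ)}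
    {H : Matrix (Fin m) (Fin n) ℂ} :
    H ∈ annih A B ↔ ∀ u ∈ A, ∀ v ∈ B, u ⬝ᵥ H *ᵥ v = 0 :=
  Iff.rfl

lemma mem_annih_range {a b : ℕ} (U : Matrix (Fin m) (Fin a) ℂ) (V : Matrix (Fin n) (Fin b) ℂ)
    (H : Matrix (Fin m) (Fin n) ℂ) :
    H ∈ annih (LinearMap.range U.mulVecLin) (LinearMap.range V.mulVecLin) ↔
      U.transpose * H * V = 0 := by
  have key : ∀ x y, (U *ᵥ x) ⬝ᵥ H *ᵥ (V *ᵥ y) = x ⬝ᵥ (U.transpose * H * V) *ᵥ y := fun x y => by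
    rw [← mulVec_mulVec, ← mulVec_mulVec, dotProduct_mulVec x, vecMul_transpose]
  constructor
  · intro h
    ext i j
    have := h _ ⟨Pi.single i 1, rfl⟩ _ ⟨Pi.single j 1, rfl⟩
    rw [mulVecLin_apply, mulVecLin_apply, key] at this
    simpa using this
  · rintro h _ ⟨x, rfl⟩ _ ⟨y, rfl⟩
    rw [mulVecLin_apply, mulVecLin_apply, key, h, zero_mulVec, dotProduct_zero]

lemma mem_annih_map (S : Matrix (Fin m) (Fin m) ℂ) (T : Matrix (Fin n) (Fin n) ℂ)
    (A : Submodule ℂ (Fin m → ℂ)) (B : Submodule ℂ (Fin n → ℂ)) (H : Matrix (Fin m) (Fin n) ℂ) :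
    H ∈ annih (A.map S.mulVecLin) (B.map T.mulVecLin) ↔ S.transpose * H * T ∈ annih A B := by
  have key : ∀ x y, (S *ᵥ x) ⬝ᵥ H *ᵥ (T *ᵥ y) = x ⬝ᵥ (S.transpose * H * T) *ᵥ y := fun x y => by
    rw [← mulVec_mulVec, ← mulVec_mulVec, dotProduct_mulVec x, vecMul_transpose]
  simp only [mem_annih, Submodule.mem_map, mulVecLin_apply, forall_exists_index, and_imp,
    forall_apply_eq_imp_iff₂, key]

/-- Every subspace of `ℂ^m` is the column space of a matrix with orthonormal columns. -/
lemma exists_isometry_range_eq {a : ℕ} (W : Gr a (Fin m → ℂ)) :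
    ∃ U : Matrix (Fin m) (Fin a) ℂ, U.conjTranspose * U = 1 ∧
      LinearMap.range U.mulVecLin = W.1 := by
  let e := (WithLp.linearEquiv 2 ℂ (Fin m → ℂ)).symm
  let W' : Submodule ℂ (EuclideanSpace ℂ (Fin m)) := W.1.map e.toLinearMap
  have hW' : finrank ℂ W' = a := by rw [LinearEquiv.finrank_map_eq]; exact W.2
  let b := (stdOrthonormalBasis ℂ W').reindex (finCongr hW')
  let U : Matrix (Fin m) (Fin a) ℂ := Matrix.of fun i j => (b j : EuclideanSpace ℂ (Fin m)) i
  have hU : U.conjTranspose * U = 1 := by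
    ext i j
    have h := orthonormal_iff_ite.1 b.orthonormal i j
    rw [Submodule.coe_inner, PiLp.inner_apply] at h
    rw [Matrix.mul_apply, Matrix.one_apply, ← h]
    refine Finset.sum_congr rfl fun k _ => ?_
    simp [U, mul_comm]
  refine ⟨U, hU, ?_⟩
  have hinj : Function.Injective U.mulVecLin := by
    intro x y h
    have h : U *ᵥ x = U *ᵥ y := h
    have := congrArg (U.conjTranspose *ᵥ ·) h
    simpa [hU] using this
  refine Submodule.eq_of_le_of_finrank_eq ?_ ?_
  · rw [range_mulVecLin, Submodule.span_le]
    rintro _ ⟨j, rfl⟩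
    obtain ⟨w, hw, hw'⟩ := (b j).2
    have : U.col j = w := by
      have h1 : w = e.symm (b j : EuclideanSpace ℂ (Fin m)) := by
        rw [← hw']; exact (e.symm_apply_apply w).symm
      rw [h1]
      rfl
    rw [this]
    exact hw
  · rw [LinearMap.finrank_range_of_inj hinj, W.2]
    simp

/-- A pair of subspaces of dimensions `a` and `b` imposes `a * b` independent conditions on a
matrix. -/
lemma finrank_annih {a b : ℕ} (A : Gr a (Fin m → ℂ)) (B : Gr b (Fin n → ℂ)) :
    finrank ℂ (annih A.1 B.1) + a * b = m * n := by
  obtain ⟨U, hU, hA⟩ := exists_isometry_range_eq A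
  obtain ⟨V, hV, hB⟩ := exists_isometry_range_eq B
  let L : Matrix (Fin m) (Fin n) ℂ →ₗ[ℂ] Matrix (Fin a) (Fin b) ℂ :=
    { toFun := fun H => U.transpose * H * V
      map_add' := fun H H' => by rw [Matrix.mul_add, Matrix.add_mul]
      map_smul' := fun r H => by simp }
  have hker : LinearMap.ker L = annih A.1 B.1 := by
    ext H
    rw [← hA, ← hB, mem_annih_range]
    rfl
  have hsurj : Function.Surjective L := fun X => by
    -- `Uᴴ` and `Vᴴ` are left inverses of `U` and `V`.
    refine ⟨U.conjTranspose.transpose * X * V.conjTranspose, ?_⟩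
    change U.transpose * (U.conjTranspose.transpose * X * V.conjTranspose) * V = X
    have h1 : U.transpose * U.conjTranspose.transpose = 1 := by
      rw [← Matrix.transpose_mul, hU, Matrix.transpose_one]
    calc _ = (U.transpose * U.conjTranspose.transpose) * X * (V.conjTranspose * V) := by
          simp only [Matrix.mul_assoc]
      _ = X := by rw [h1, hV, Matrix.one_mul, Matrix.mul_one]
  have h := LinearMap.finrank_range_add_finrank_ker L
  rw [LinearMap.range_eq_top.2 hsurj, hker, finrank_top] at h
  simp only [Module.finrank_matrix, Fintype.card_fin, Module.finrank_self, mul_one] at h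
  omega

/-! ### Compact sets of representatives -/

lemma isCompact_isometries (a : ℕ) :
    IsCompact {U : Matrix (Fin m) (Fin a) ℂ | U.conjTranspose * U = 1} := by
  have hbox : IsCompact (Set.univ.pi fun _ => Set.univ.pi fun _ => Metric.closedBall (0 : ℂ) 1 :
      Set (Fin m → Fin a → ℂ)) :=
    isCompact_univ_pi fun _ => isCompact_univ_pi fun _ => isCompact_closedBall _ _
  refine IsCompact.of_isClosed_subset (X := Matrix (Fin m) (Fin a) ℂ) hbox
    (isClosed_eq (by fun_prop) (by fun_prop)) fun U hU i _ j _ => ?_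
  have h := congrFun (congrFun (show U.conjTranspose * U = 1 from hU) j) j
  rw [Matrix.mul_apply, Matrix.one_apply_eq] at h
  have h' : ∑ k, ‖U k j‖ ^ 2 = 1 := by
    have := congrArg Complex.re h
    simp only [Matrix.conjTranspose_apply, Complex.re_sum, Complex.one_re] at this
    rw [← this]
    refine Finset.sum_congr rfl fun k _ => ?_
    rw [← Complex.normSq_eq_norm_sq, Complex.normSq_apply]
    simp
  have h2 : ‖U i j‖ ^ 2 ≤ 1 := h' ▸
    Finset.single_le_sum (f := fun k => ‖U k j‖ ^ 2) (fun _ _ => sq_nonneg _) (Finset.mem_univ i)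
  rw [mem_closedBall_zero_iff]
  exact (sq_le_one_iff₀ (norm_nonneg _)).1 h2

/-- The matrices whose largest entry has modulus one. They represent all points of the projective
space of matrices. -/
def unitMatrices (m n : ℕ) : Set (Matrix (Fin m) (Fin n) ℂ) :=
  {H | ‖(fun i j => H i j : Fin m → Fin n → ℂ)‖ = 1}

lemma isCompact_unitMatrices : IsCompact (unitMatrices m n) := by
  have h := isCompact_sphere (0 : Fin m → Fin n → ℂ) 1
  have e : Metric.sphere (0 : Fin m → Fin n → ℂ) 1 = {H | ‖H‖ = 1} := by ext; simp
  rw [e] at h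
  exact h

lemma ne_zero_of_mem_unitMatrices {H : Matrix (Fin m) (Fin n) ℂ} (h : H ∈ unitMatrices m n) :
    H ≠ 0 := by
  rintro rfl
  have h : ‖(0 : Fin m → Fin n → ℂ)‖ = 1 := h
  simp at h

lemma exists_unitMatrices_mk_eq (x : ℙ ℂ (Matrix (Fin m) (Fin n) ℂ)) :
    ∃ (H : _) (h : H ∈ unitMatrices m n),
      Projectivization.mk ℂ H (ne_zero_of_mem_unitMatrices h) = x := by
  induction x using Projectivization.ind with
  | h H hH =>
    let H' : Fin m → Fin n → ℂ := H
    have hH' : ‖H'‖ ≠ 0 := norm_ne_zero_iff.2 hH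
    have hmem : ‖(‖H'‖ : ℂ)⁻¹ • H'‖ = 1 := by
      rw [norm_smul, norm_inv, Complex.norm_real, norm_norm, inv_mul_cancel₀ hH']
    refine ⟨(‖H'‖ : ℂ)⁻¹ • H, hmem, ?_⟩
    rw [Projectivization.mk_eq_mk_iff']
    exact ⟨_, rfl⟩

/-! ### The alignment equations in terms of minors -/

/-- By Cramer's rule, the entries of `U * adj(U_r)`, where `U_r` consists of the rows `r` of `U`, are
maximal minors of `U`, in which rows may be repeated or permuted. -/
lemma mul_adjugate_submatrix_apply {a : ℕ} (U : Matrix (Fin m) (Fin a) ℂ) (r : Fin a → Fin m)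
    (i : Fin m) (j : Fin a) :
    (U * (U.submatrix r id).adjugate) i j =
      (U.submatrix (Function.update r j i) id).det := by
  have : U.submatrix (Function.update r j i) id = (U.submatrix r id).updateRow j (U i) := by
    ext k l
    by_cases h : k = j
    · subst h; simp
    · simp [h]
  rw [this, ← Matrix.cramer_transpose_apply,
    Matrix.cramer_eq_adjugate_mulVec, ← Matrix.adjugate_transpose, Matrix.mulVec_transpose]
  rfl

/-- An injective matrix has an invertible maximal square submatrix. -/
lemma exists_isUnit_submatrix {a : ℕ} (U : Matrix (Fin m) (Fin a) ℂ)
    (hU : finrank ℂ (LinearMap.range U.mulVecLin) = a) :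
    ∃ r : Fin a → Fin m, IsUnit (U.submatrix r id) := by
  have h1 : finrank ℂ (Submodule.span ℂ (Set.range U)) = a := by
    have := U.rank_eq_finrank_span_row
    rw [Matrix.rank, hU] at this
    exact this.symm
  obtain ⟨f, hf, -, hli⟩ := Submodule.exists_fun_fin_finrank_span_eq ℂ (Set.range U)
  choose r hr using hf
  refine ⟨r ∘ finCongr h1.symm, ?_⟩
  rw [← Matrix.linearIndependent_rows_iff_isUnit]
  have e : (U.submatrix (r ∘ finCongr h1.symm) id).row = f ∘ finCongr h1.symm :=
    funext fun i => hr _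
  rw [e]
  exact hli.comp _ (finCongr h1.symm).injective

/-- The alignment equations of one link, expressed by maximal minors: the sums are the entries of
`(U * adj(U_r))ᵀ H (V * adj(V_r'))`. -/
lemma aligned_iff_forall_minors {a b : ℕ} (U : Matrix (Fin m) (Fin a) ℂ)
    (V : Matrix (Fin n) (Fin b) ℂ) (hU : finrank ℂ (LinearMap.range U.mulVecLin) = a)
    (hV : finrank ℂ (LinearMap.range V.mulVecLin) = b) (H : Matrix (Fin m) (Fin n) ℂ) :
    U.transpose * H * V = 0 ↔
      ∀ (r : Fin a → Fin m) (s : Fin a) (r' : Fin b → Fin n) (s' : Fin b),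
        ∑ i, ∑ j, (U.submatrix (Function.update r s i) id).det * H i j *
          (V.submatrix (Function.update r' s' j) id).det = 0 := by
  have key : ∀ (r : Fin a → Fin m) (s : Fin a) (r' : Fin b → Fin n) (s' : Fin b),
      ∑ i, ∑ j, (U.submatrix (Function.update r s i) id).det * H i j *
          (V.submatrix (Function.update r' s' j) id).det =
        ((U.submatrix r id).adjugate.transpose * (U.transpose * H * V) *
          (V.submatrix r' id).adjugate) s s' := by
    intro r s r' s'
    have : (U.submatrix r id).adjugate.transpose * (U.transpose * H * V) *
          (V.submatrix r' id).adjugate = (U * (U.submatrix r id).adjugate).transpose * H *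
          (V * (V.submatrix r' id).adjugate) := by
      rw [Matrix.transpose_mul]
      simp only [Matrix.mul_assoc]
    rw [this, Matrix.mul_apply, Finset.sum_comm]
    refine Finset.sum_congr rfl fun j _ => ?_
    rw [Matrix.mul_apply, Finset.sum_mul]
    refine Finset.sum_congr rfl fun i _ => ?_
    rw [Matrix.transpose_apply, mul_adjugate_submatrix_apply, mul_adjugate_submatrix_apply]
  simp only [key]
  constructor
  · intro h r s r' s'
    rw [h]
    simp
  · intro h
    obtain ⟨r, hr⟩ := exists_isUnit_submatrix U hU
    obtain ⟨r', hr'⟩ := exists_isUnit_submatrix V hV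
    have h0 : (U.submatrix r id).adjugate.transpose * (U.transpose * H * V) *
          (V.submatrix r' id).adjugate = 0 := Matrix.ext fun s s' => h r s r' s'
    have hu : IsUnit (U.submatrix r id).adjugate.transpose := by
      rw [Matrix.isUnit_transpose, Matrix.isUnit_iff_isUnit_det, Matrix.det_adjugate]
      exact ((Matrix.isUnit_iff_isUnit_det _).1 hr).pow _
    have hv : IsUnit (V.submatrix r' id).adjugate := by
      rw [Matrix.isUnit_iff_isUnit_det, Matrix.det_adjugate]
      exact ((Matrix.isUnit_iff_isUnit_det _).1 hr').pow _
    obtain ⟨x, hx⟩ := hu.exists_left_inv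
    obtain ⟨y, hy⟩ := hv.exists_right_inv
    have h1 : x * ((U.submatrix r id).adjugate.transpose * (U.transpose * H * V) *
          (V.submatrix r' id).adjugate) * y =
        (x * (U.submatrix r id).adjugate.transpose) * (U.transpose * H * V) *
          ((V.submatrix r' id).adjugate * y) := by simp only [Matrix.mul_assoc]
    rwa [h0, hx, hy, Matrix.mul_zero, Matrix.zero_mul, Matrix.one_mul, Matrix.mul_one,
      eq_comm] at h1

end Matrices

namespace Channel

variable {P : Channel}

/-! ### The solution variety in terms of subspaces -/

lemma projEquiv_mk {V : Type*} [AddCommGroup V] [Module ℂ V] (v : V) (hv : v ≠ 0) :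
    (projEquiv V (Projectivization.mk ℂ v hv)).1 = Submodule.span ℂ {v} :=
  Projectivization.submodule_mk v hv

lemma Affine.Represents.aligned_iff {t : P.Affine} {z : P.Inp × P.Out} (h : t.Represents z) :
    t.Aligned ↔ ∀ p, (projEquiv _ (z.1 p)).1 ≤
      annih (z.2.1 (P.rx p)).1 (z.2.2 (P.tx p)).1 := by
  refine forall_congr' fun p => ?_
  obtain ⟨hp, hpz⟩ := h.1 p
  rw [← hpz, projEquiv_mk, Submodule.span_singleton_le_iff_mem, ← h.2.1, ← h.2.2, mem_annih_range]

lemma exists_represents (z : P.Inp × P.Out) : ∃ t : P.Affine, t.Represents z := by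
  choose U _ hU using fun k => exists_isometry_range_eq (z.2.1 k)
  choose V _ hV using fun l => exists_isometry_range_eq (z.2.2 l)
  exact ⟨⟨fun p => (z.1 p).rep, U, V⟩,
    fun p => ⟨(z.1 p).rep_nonzero, (z.1 p).mk_rep⟩, hU, hV⟩

/-- The alignment equations do not depend on the representatives: a point belongs to the solution
variety if and only if each line of channel matrices annihilates the pair formed by the decoding
and the precoding subspace. -/
lemma mem_solutionVariety_iff {z : P.Inp × P.Out} :
    z ∈ P.solutionVariety ↔ ∀ p, (projEquiv _ (z.1 p)).1 ≤
      annih (z.2.1 (P.rx p)).1 (z.2.2 (P.tx p)).1 := by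
  constructor
  · intro h
    obtain ⟨t, ht⟩ := exists_represents z
    exact ht.aligned_iff.1 (h t ht)
  · exact fun h t ht => ht.aligned_iff.2 h

lemma Affine.Represents.mem_solutionVariety_iff_aligned {t : P.Affine} {z : P.Inp × P.Out}
    (h : t.Represents z) : z ∈ P.solutionVariety ↔ t.Aligned :=
  mem_solutionVariety_iff.trans h.aligned_iff.symm

/-! ### Nonemptiness -/

lemma exists_gr {a n : ℕ} (h : a ≤ n) : Nonempty (Gr a (Fin n → ℂ)) := by
  have hli := (Pi.basisFun ℂ (Fin n)).linearIndependent.comp _ (Fin.castLE_injective h)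
  exact ⟨⟨_, (finrank_span_eq_card hli).trans (Fintype.card_fin a)⟩⟩

lemma mul_lt_mul_of_mem
    (hR : ∀ k ∈ P.ΦR, 1 ≤ P.d k ∧ P.d k ≤ P.N k) (hT : ∀ l ∈ P.ΦT, 1 ≤ P.d l ∧ P.d l ≤ P.M l)
    (hd : ∀ p ∈ P.Φ, P.d p.1 + P.d p.2 < P.N p.1 + P.M p.2) (p : P.Φ) :
    P.d (P.rx p) * P.d (P.tx p) < P.N (P.rx p) * P.M (P.tx p) := by
  have h1 := hR _ (P.rx p).2
  have h2 := hT _ (P.tx p).2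
  have h3 : P.d (P.rx p) + P.d (P.tx p) < P.N (P.rx p) + P.M (P.tx p) := hd p p.2
  rcases h1.2.lt_or_eq with h | h
  · exact Nat.mul_lt_mul_of_lt_of_le h h2.2 (by omega)
  · exact Nat.mul_lt_mul_of_le_of_lt h1.2 (by omega) (by omega)

lemma solutionVariety_nonempty
    (hR : ∀ k ∈ P.ΦR, 1 ≤ P.d k ∧ P.d k ≤ P.N k) (hT : ∀ l ∈ P.ΦT, 1 ≤ P.d l ∧ P.d l ≤ P.M l)
    (hd : ∀ p ∈ P.Φ, P.d p.1 + P.d p.2 < P.N p.1 + P.M p.2) :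
    P.solutionVariety.Nonempty := by
  let U : P.Dec := fun k => (exists_gr (hR k k.2).2).some
  let V : P.Pre := fun l => (exists_gr (hT l l.2).2).some
  have key : ∀ p : P.Φ, ∃ H ∈ annih (U (P.rx p)).1 (V (P.tx p)).1, H ≠ 0 := by
    intro p
    refine Submodule.exists_mem_ne_zero_of_ne_bot fun h => ?_
    have h1 := finrank_annih (U (P.rx p)) (V (P.tx p))
    rw [h, finrank_bot, zero_add] at h1
    exact (mul_lt_mul_of_mem hR hT hd p).ne h1
  choose H hH hH0 using key
  refine ⟨(fun p => Projectivization.mk ℂ (H p) (hH0 p), U, V),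
    mem_solutionVariety_iff.2 fun p => ?_⟩
  rw [projEquiv_mk, Submodule.span_singleton_le_iff_mem]
  exact hH p

/-! ### Compactness -/

variable (P) in
/-- The aligned data consisting of channel matrices normalized to have largest entry of modulus
one, and decoders and precoders with orthonormal columns. -/
def normalizedSolutions : Set (((p : P.Φ) → P.Mat p) ×
    ((k : P.ΦR) → Matrix (Fin (P.N k)) (Fin (P.d k)) ℂ) ×
    ((l : P.ΦT) → Matrix (Fin (P.M l)) (Fin (P.d l)) ℂ)) :=
  (Set.univ.pi (fun _ => unitMatrices _ _) ×ˢ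
    (Set.univ.pi (fun _ => {U | U.conjTranspose * U = 1}) ×ˢ
      Set.univ.pi (fun _ => {V | V.conjTranspose * V = 1}))) ∩
  ⋂ p, {y | (y.2.1 (P.rx p)).transpose * y.1 p * y.2.2 (P.tx p) = 0}

lemma isCompact_normalizedSolutions : IsCompact P.normalizedSolutions := by
  refine IsCompact.inter_right ?_ (isClosed_iInter fun p => isClosed_eq ?_ continuous_const)
  · exact (isCompact_univ_pi fun _ => isCompact_unitMatrices).prod
      ((isCompact_univ_pi fun _ => isCompact_isometries _).prod
        (isCompact_univ_pi fun _ => isCompact_isometries _))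
  · fun_prop

lemma finrank_range_of_isometry {m a : ℕ} {U : Matrix (Fin m) (Fin a) ℂ}
    (hU : U.conjTranspose * U = 1) : finrank ℂ (LinearMap.range U.mulVecLin) = a := by
  rw [LinearMap.finrank_range_of_inj, finrank_fin_fun]
  intro x y h
  have := congrArg (U.conjTranspose.mulVec ·) (show U.mulVec x = U.mulVec y from h)
  simpa [hU] using this

/-- The column space of a matrix with orthonormal columns. -/
def colSpace {m a : ℕ} (U : Matrix (Fin m) (Fin a) ℂ) (hU : U.conjTranspose * U = 1) :
    Gr a (Fin m → ℂ) :=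
  ⟨LinearMap.range U.mulVecLin, finrank_range_of_isometry hU⟩

/-- The point of `ℋ × 𝒮` represented by normalized data. -/
def ofNormalized (y : P.normalizedSolutions) : P.Inp × P.Out :=
  (fun p => Projectivization.mk ℂ (y.1.1 p) (ne_zero_of_mem_unitMatrices (y.2.1.1 p trivial)),
    fun k => colSpace (y.1.2.1 k) (y.2.1.2.1 k trivial),
    fun l => colSpace (y.1.2.2 l) (y.2.1.2.2 l trivial))

lemma continuous_ofNormalized : Continuous (ofNormalized (P := P)) := by
  refine Continuous.prodMk (continuous_pi fun p => ?_)
    (Continuous.prodMk (continuous_pi fun k => ?_) (continuous_pi fun l => ?_))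
  · refine continuous_of_range_eq (projEquiv (P.Mat p)) _
      (fun y => (LinearMap.toSpanSingleton ℂ (P.Mat p) (y.1.1 p)).comp (LinearMap.proj 0))
      (fun x L => ?_) (fun y => ?_)
    · have hL : Continuous L := L.continuous_of_finiteDimensional
      simp only [LinearMap.comp_apply, LinearMap.toSpanSingleton_apply, map_smul]
      fun_prop
    · rw [projEquiv_mk, LinearMap.range_comp_of_range_eq_top, LinearMap.range_toSpanSingleton]
      exact LinearMap.range_eq_top.2 fun c => ⟨fun _ => c, rfl⟩
  · refine continuous_of_range_eq (Equiv.refl (Gr _ _)) _ (fun y => (y.1.2.1 k).mulVecLin)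
      (fun x L => ?_) (fun y => rfl)
    have hL : Continuous L := L.continuous_of_finiteDimensional
    simp only [Matrix.mulVecLin_apply]
    fun_prop
  · refine continuous_of_range_eq (Equiv.refl (Gr _ _)) _ (fun y => (y.1.2.2 l).mulVecLin)
      (fun x L => ?_) (fun y => rfl)
    have hL : Continuous L := L.continuous_of_finiteDimensional
    simp only [Matrix.mulVecLin_apply]
    fun_prop

lemma range_ofNormalized : Set.range (ofNormalized (P := P)) = P.solutionVariety := by
  ext z
  constructor
  · rintro ⟨y, rfl⟩
    let t : P.Affine := ⟨y.1.1, y.1.2.1, y.1.2.2⟩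
    have ht : t.Represents (ofNormalized y) := ⟨fun p => ⟨_, rfl⟩, fun k => rfl, fun l => rfl⟩
    exact ht.mem_solutionVariety_iff_aligned.2 fun p => Set.mem_iInter.1 y.2.2 p
  · intro hz
    choose H hH hHz using fun p => exists_unitMatrices_mk_eq (z.1 p)
    choose U hU hUz using fun k => exists_isometry_range_eq (z.2.1 k)
    choose V hV hVz using fun l => exists_isometry_range_eq (z.2.2 l)
    have hal := hz ⟨H, U, V⟩ ⟨fun p => ⟨_, hHz p⟩, hUz, hVz⟩
    refine ⟨⟨(H, U, V), ⟨fun p _ => hH p, fun k _ => hU k, fun l _ => hV l⟩,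
      Set.mem_iInter.2 hal⟩, ?_⟩
    exact Prod.ext (funext hHz) (Prod.ext (funext fun k => Subtype.ext (hUz k))
      (funext fun l => Subtype.ext (hVz l)))

lemma isCompact_solutionVariety : IsCompact P.solutionVariety := by
  have := isCompact_iff_compactSpace.1 (isCompact_normalizedSolutions (P := P))
  rw [← range_ofNormalized]
  exact isCompact_range continuous_ofNormalized

/-! ### Algebraicity -/

variable (P) in
/-- The grading that records the degree in the coordinates of each projective factor. -/
abbrev weight (c : Σ i, P.CoordIdx i) : P.Factor → ℕ := Pi.single c.1 1

/-- Every minor with prescribed rows, possibly repeated or out of order, is a form of degree one in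
the Plücker coordinates. -/
lemma exists_minor_form (i : P.Factor) {m a : ℕ} (e : (Fin a ↪o Fin m) → P.CoordIdx i)
    (M : P.Affine → Matrix (Fin m) (Fin a) ℂ)
    (hM : ∀ (t : P.Affine) (r : Fin a ↪o Fin m), t.coord ⟨i, e r⟩ = ((M t).submatrix r id).det) (r : Fin a → Fin m) :
    ∃ q : MvPolynomial (Σ i, P.CoordIdx i) ℂ,
      q.IsWeightedHomogeneous P.weight (Pi.single i 1) ∧
      ∀ t : P.Affine, MvPolynomial.eval t.coord q = ((M t).submatrix r id).det := by
  by_cases hr : Function.Injective r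
  · have hmono : StrictMono (r ∘ Tuple.sort r) :=
      (Tuple.monotone_sort r).strictMono_of_injective (hr.comp (Tuple.sort r).injective)
    let s : ℂ := ((Equiv.Perm.sign (Tuple.sort r) : ℤ) : ℂ)
    -- Sorting the rows gives a Plücker coordinate, up to the sign of the sorting permutation.
    refine ⟨MvPolynomial.C s * MvPolynomial.X ⟨i, e (OrderEmbedding.ofStrictMono _ hmono)⟩,
      ?_, fun t => ?_⟩
    · have := (MvPolynomial.isWeightedHomogeneous_C P.weight s).mul
        (MvPolynomial.isWeightedHomogeneous_X ℂ P.weight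
          ⟨i, e (OrderEmbedding.ofStrictMono _ hmono)⟩)
      rwa [zero_add] at this
    · rw [map_mul, MvPolynomial.eval_C, MvPolynomial.eval_X, hM]
      have h1 : (M t).submatrix (OrderEmbedding.ofStrictMono _ hmono) id =
          ((M t).submatrix r id).submatrix (Tuple.sort r) id := rfl
      have h2 : s * s = 1 := by
        rcases Int.units_eq_one_or (Equiv.Perm.sign (Tuple.sort r)) with h | h <;> simp [s, h]
      rw [h1, Matrix.det_permute, ← mul_assoc, h2, one_mul]
  · obtain ⟨j, k, hjk, hne⟩ := Function.not_injective_iff.1 hr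
    refine ⟨0, MvPolynomial.isWeightedHomogeneous_zero _ _ _, fun t => ?_⟩
    rw [map_zero, Matrix.det_zero_of_row_eq hne]
    funext l
    simp [hjk]

lemma isAlgebraicSubvariety_solutionVariety : P.IsAlgebraicSubvariety P.solutionVariety := by
  choose qU hqU hqUt using fun k : P.ΦR => exists_minor_form (P := P) (.inr (.inl k))
    (fun r => r) (fun t => t.U k) (fun t r => rfl)
  choose qV hqV hqVt using fun l : P.ΦT => exists_minor_form (P := P) (.inr (.inr l))
    (fun r => r) (fun t => t.V l) (fun t r => rfl)
  let q : (Σ p : P.Φ, ((Fin (P.d (P.rx p)) → Fin (P.N (P.rx p))) × Fin (P.d (P.rx p))) ×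
      ((Fin (P.d (P.tx p)) → Fin (P.M (P.tx p))) × Fin (P.d (P.tx p)))) →
      MvPolynomial (Σ i, P.CoordIdx i) ℂ := fun ⟨p, ⟨r, s⟩, ⟨r', s'⟩⟩ =>
    ∑ i, ∑ j, qU (P.rx p) (Function.update r s i) * MvPolynomial.X ⟨.inl p, (i, j)⟩ *
      qV (P.tx p) (Function.update r' s' j)
  refine ⟨Set.range q, ?_, fun z t ht => ?_⟩
  · rintro _ ⟨⟨p, ⟨r, s⟩, ⟨r', s'⟩⟩, rfl⟩
    refine ⟨Pi.single (.inr (.inl (P.rx p))) 1 + Pi.single (.inl p) 1 +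
      Pi.single (.inr (.inr (P.tx p))) 1, ?_⟩
    refine MvPolynomial.IsWeightedHomogeneous.sum _ _ _ fun i _ =>
      MvPolynomial.IsWeightedHomogeneous.sum _ _ _ fun j _ => ?_
    exact ((hqU _ _).mul (MvPolynomial.isWeightedHomogeneous_X ℂ P.weight _)).mul (hqV _ _)
  · rw [ht.mem_solutionVariety_iff_aligned, Set.forall_mem_range, Sigma.forall]
    refine forall_congr' fun p => ?_
    rw [aligned_iff_forall_minors _ _ (by rw [ht.2.1]; exact (z.2.1 _).2)
      (by rw [ht.2.2]; exact (z.2.2 _).2)]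
    simp only [Prod.forall, q, map_sum, map_mul, hqUt, hqVt, MvPolynomial.eval_X]
    rfl

end Channel

/-! ### Submanifold charts -/

section Submanifold

variable {E : Type*} [NormedAddCommGroup E] [NormedSpace ℂ E] {H : Type*} [TopologicalSpace H]
  (I : ModelWithCorners ℂ E H) {X : Type*} [TopologicalSpace X]

/-- To see that `φ` maps `Z` onto a piece of `F`, it suffices to look at the inverse chart. -/
lemma extend_image_eq (φ : OpenPartialHomeomorph X H) (Z : Set X) (F : Set E)
    (h : ∀ y ∈ φ.target, φ.symm y ∈ Z ↔ I y ∈ F) :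
    φ.extend I '' (φ.source ∩ Z) = (φ.extend I).target ∩ F := by
  rw [OpenPartialHomeomorph.extend_target]
  ext w
  constructor
  · rintro ⟨x, ⟨hx, hxZ⟩, rfl⟩
    rw [OpenPartialHomeomorph.extend_coe, Function.comp_apply]
    refine ⟨⟨?_, Set.mem_range_self _⟩, ?_⟩
    · rw [Set.mem_preimage, I.left_inv]
      exact φ.map_source hx
    · rw [← h _ (φ.map_source hx), φ.left_inv hx]
      exact hxZ
  · rintro ⟨⟨hy, ⟨y, rfl⟩⟩, hyF⟩
    rw [Set.mem_preimage, I.left_inv] at hy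
    refine ⟨φ.symm y, ⟨φ.map_target hy, (h y hy).2 hyF⟩, ?_⟩
    rw [OpenPartialHomeomorph.extend_coe, Function.comp_apply, φ.right_inv hy]

variable [ChartedSpace H X]

lemma trans_mem_maximalAtlas [IsManifold I ω X] {c : OpenPartialHomeomorph X H}
    (hc : c ∈ atlas H X) {ψ : OpenPartialHomeomorph H H} (hψ : ψ ∈ contDiffGroupoid ω I) :
    c.trans ψ ∈ IsManifold.maximalAtlas I ω X := by
  intro e he
  have h1 := HasGroupoid.compatible (G := contDiffGroupoid ω I) hc he
  have h2 := HasGroupoid.compatible (G := contDiffGroupoid ω I) he hc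
  rw [OpenPartialHomeomorph.trans_symm_eq_symm_trans_symm, OpenPartialHomeomorph.trans_assoc,
    ← OpenPartialHomeomorph.trans_assoc e.symm]
  exact ⟨(contDiffGroupoid ω I).trans ((contDiffGroupoid ω I).symm hψ) h1,
    (contDiffGroupoid ω I).trans h2 hψ⟩

end Submanifold

/-! ### Moving a pair of subspaces -/

section Moving

lemma shear_neg_shear {a c : ℕ} (X : Hom a c) (v) : shear (-X) (shear X v) = v := by
  rw [← shear_symm, LinearEquiv.symm_apply_apply]

/-- The matrix of the automorphism of `ℂ^n` that is a shear in the coordinates given by a frame. -/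
def shearMatrix {a c n : ℕ} (g : Frame a c (Fin n → ℂ)) (X : Hom a c) :
    Matrix (Fin n) (Fin n) ℂ :=
  LinearMap.toMatrix' ((g.symm.trans (shear X)).trans g).toLinearMap

variable {a c n : ℕ} (g : Frame a c (Fin n → ℂ))

lemma shearMatrix_mulVec (X : Hom a c) (v) :
    (shearMatrix g X).mulVec v = g (shear X (g.symm v)) := by
  rw [shearMatrix, LinearMap.toMatrix'_mulVec]
  rfl

lemma shearMatrix_neg_mul (X : Hom a c) : shearMatrix g (-X) * shearMatrix g X = 1 := by
  refine Matrix.ext_of_mulVec_single fun i => ?_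
  rw [← Matrix.mulVec_mulVec, shearMatrix_mulVec, shearMatrix_mulVec, g.symm_apply_apply,
    shear_neg_shear, g.apply_symm_apply, Matrix.one_mulVec]

lemma shearMatrix_mul_neg (X : Hom a c) : shearMatrix g X * shearMatrix g (-X) = 1 := by
  simpa using shearMatrix_neg_mul g (-X)

lemma shearMatrix_zero : shearMatrix g 0 = 1 := by
  refine Matrix.ext_of_mulVec_single fun i => ?_
  rw [shearMatrix_mulVec, shear_zero, LinearEquiv.refl_apply, g.apply_symm_apply,
    Matrix.one_mulVec]

lemma graphPt_eq_map_shearMatrix (X : Hom a c) :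
    (graphPt g X).1 = (graphPt g 0).1.map (shearMatrix g X).mulVecLin := by
  ext v
  simp only [mem_graphPt, Submodule.mem_map, Matrix.mulVecLin_apply, shearMatrix_mulVec]
  constructor
  · rintro ⟨x, rfl⟩
    exact ⟨_, ⟨x, rfl⟩, by simp [shear_apply]⟩
  · rintro ⟨_, ⟨x, rfl⟩, rfl⟩
    exact ⟨x, by simp [shear_apply]⟩

lemma contDiff_shearMatrix_apply (i j : Fin n) :
    ContDiff ℂ ω fun X : Hom a c => shearMatrix g X i j := by
  have h : ∀ X : Hom a c, shearMatrix g X i j =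
      (LinearMap.proj i ∘ₗ g.toLinearMap).toContinuousLinearMap
        ((g.symm (Pi.single j 1)).1, (g.symm (Pi.single j 1)).2 + X (g.symm (Pi.single j 1)).1) := by
    intro X
    have := congrFun (shearMatrix_mulVec g X (Pi.single j 1)) i
    rwa [Matrix.mulVec_single_one] at this
  simp only [h]
  fun_prop

variable {b e m : ℕ} (g' : Frame b e (Fin m → ℂ))

/-- The action on matrices, regarded as bilinear forms, of the shears of `ℂ^n` and `ℂ^m` that
carry the centres of the charts given by `g` and `g'` to the subspaces with coordinates `X` and
`Y`. -/
def pullback (X : Hom a c) (Y : Hom b e) :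
    Matrix (Fin n) (Fin m) ℂ ≃ₗ[ℂ] Matrix (Fin n) (Fin m) ℂ where
  toFun H := (shearMatrix g X).transpose * H * shearMatrix g' Y
  invFun H := (shearMatrix g (-X)).transpose * H * shearMatrix g' (-Y)
  map_add' H H' := by rw [Matrix.mul_add, Matrix.add_mul]
  map_smul' r H := by simp
  left_inv H := by
    calc _ = (shearMatrix g X * shearMatrix g (-X)).transpose * H *
          (shearMatrix g' Y * shearMatrix g' (-Y)) := by
          rw [Matrix.transpose_mul]; simp only [Matrix.mul_assoc]
      _ = H := by simp [shearMatrix_mul_neg]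
  right_inv H := by
    calc _ = (shearMatrix g (-X) * shearMatrix g X).transpose * H *
          (shearMatrix g' (-Y) * shearMatrix g' Y) := by
          rw [Matrix.transpose_mul]; simp only [Matrix.mul_assoc]
      _ = H := by simp [shearMatrix_neg_mul]

lemma pullback_apply (X : Hom a c) (Y : Hom b e) (H) :
    pullback g g' X Y H = (shearMatrix g X).transpose * H * shearMatrix g' Y :=
  rfl

lemma pullback_zero : pullback g g' 0 0 = LinearEquiv.refl ℂ _ := by
  ext H : 1
  simp [pullback_apply, shearMatrix_zero]

/-- The pullback reduces annihilation of a moving pair of subspaces to annihilation of the pair of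
centres. -/
lemma pullback_mem_annih (X : Hom a c) (Y : Hom b e) (H) :
    pullback g g' X Y H ∈ annih (graphPt g 0).1 (graphPt g' 0).1 ↔
      H ∈ annih (graphPt g X).1 (graphPt g' Y).1 := by
  rw [graphPt_eq_map_shearMatrix g X, graphPt_eq_map_shearMatrix g' Y, mem_annih_map, pullback_apply]

lemma contDiff_linearMap_matrix {S F : Type*} [NormedAddCommGroup S] [NormedSpace ℂ S]
    [NormedAddCommGroup F] [NormedSpace ℂ F] (L : Matrix (Fin n) (Fin m) ℂ →ₗ[ℂ] F)
    {A : S → Matrix (Fin n) (Fin m) ℂ} (hA : ∀ i j, ContDiff ℂ ω fun s => A s i j) :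
    ContDiff ℂ ω fun s => L (A s) := by
  have h : ∀ s, L (A s) = ∑ i, ∑ j, A s i j • L (Matrix.single i j 1) := fun s => by
    conv_lhs => rw [Matrix.matrix_eq_sum_single (A s)]
    simp only [map_sum]
    refine Finset.sum_congr rfl fun i _ => Finset.sum_congr rfl fun j _ => ?_
    rw [← map_smul, Matrix.smul_single, smul_eq_mul, mul_one]
  simp only [h]
  exact ContDiff.sum fun i _ => ContDiff.sum fun j _ => (hA i j).smul contDiff_const

lemma contDiff_pullback {S F : Type*} [NormedAddCommGroup S] [NormedSpace ℂ S]
    [NormedAddCommGroup F] [NormedSpace ℂ F] (L : Matrix (Fin n) (Fin m) ℂ →ₗ[ℂ] F)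
    {X : S → Hom a c} {Y : S → Hom b e} (hX : ContDiff ℂ ω X) (hY : ContDiff ℂ ω Y) (H) :
    ContDiff ℂ ω fun s => L (pullback g g' (X s) (Y s) H) := by
  refine contDiff_linearMap_matrix L fun i j => ?_
  simp only [pullback_apply, Matrix.mul_apply, Matrix.transpose_apply]
  exact ContDiff.sum fun k _ => (ContDiff.sum fun l _ =>
    ((contDiff_shearMatrix_apply g l i).comp hX).mul contDiff_const).mul
      ((contDiff_shearMatrix_apply g' k j).comp hY)

variable {f : ℕ} (gH : Frame 1 f (Matrix (Fin n) (Fin m) ℂ))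

/-- A frame in whose affine chart of the projective space of matrices, the matrices annihilating
the pair of subspaces with coordinates `X` and `Y` are described by equations independent of
`X` and `Y`. -/
def movingFrame (X : Hom a c) (Y : Hom b e) : Frame 1 f (Matrix (Fin n) (Fin m) ℂ) :=
  gH.trans (pullback g g' X Y).symm

lemma movingFrame_zero : movingFrame g g' gH 0 0 = gH := by
  rw [movingFrame, pullback_zero]
  rfl

lemma contDiff_chg_movingFrame {S : Type*} [NormedAddCommGroup S] [NormedSpace ℂ S]
    {X : S → Hom a c} {Y : S → Hom b e} (hX : ContDiff ℂ ω X) (hY : ContDiff ℂ ω Y) :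
    ContDiff ℂ ω fun s => chg gH (movingFrame g g' gH (X s) (Y s)) :=
  contDiff_clm_apply_iff.2 fun v =>
    contDiff_pullback g g' gH.symm.toLinearMap hX hY (gH v)

lemma contDiff_chg_movingFrame' {S : Type*} [NormedAddCommGroup S] [NormedSpace ℂ S]
    {X : S → Hom a c} {Y : S → Hom b e} (hX : ContDiff ℂ ω X) (hY : ContDiff ℂ ω Y) :
    ContDiff ℂ ω fun s => chg (movingFrame g g' gH (X s) (Y s)) gH :=
  contDiff_clm_apply_iff.2 fun v =>
    contDiff_pullback g g' gH.symm.toLinearMap hX.neg hY.neg (gH v)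

end Moving

section Linear

variable {c : ℕ} {V : Type*} [AddCommGroup V] [Module ℂ V]

/-- The lines contained in `W` in the affine chart of the projective space given by the frame `g`,
provided that the centre of the chart is one of them: a line corresponds to the value at `1` of
its coordinate in `Hom 1 c`. -/
def linesIn (g : Frame 1 c V) (W : Submodule ℂ V) : Submodule ℂ (Fin c → ℂ) :=
  W.comap (g.toLinearMap ∘ₗ LinearMap.inr ℂ _ _)

lemma mem_linesIn {g : Frame 1 c V} {W : Submodule ℂ V} {y : Fin c → ℂ} :
    y ∈ linesIn g W ↔ g (0, y) ∈ W :=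
  Iff.rfl

lemma eq_smul_one (x : Fin 1 → ℂ) : x = x 0 • (1 : Fin 1 → ℂ) := by
  funext i
  rw [Subsingleton.elim i 0]
  simp

lemma graphPt_le_iff {g : Frame 1 c V} {W : Submodule ℂ V} (hW : (graphPt g 0).1 ≤ W)
    {h : Hom 1 c} : (graphPt g h).1 ≤ W ↔ h 1 ∈ linesIn g W := by
  have h0 : ∀ x, g (x, 0) ∈ W := fun x => hW (mem_graphPt.2 ⟨x, rfl⟩)
  have hadd : ∀ x, g (x, h x) = g (x, 0) + g (0, h x) := fun x => by rw [← map_add]; simp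
  rw [mem_linesIn]
  constructor
  · intro hle
    have h1 := hle (mem_graphPt.2 ⟨1, rfl⟩)
    rw [hadd] at h1
    exact (W.add_mem_iff_right (h0 1)).1 h1
  · rintro hh _ hv
    obtain ⟨x, rfl⟩ := mem_graphPt.1 hv
    have h1 : ((0, h x) : (Fin 1 → ℂ) × (Fin c → ℂ)) = x 0 • (0, h 1) := by
      conv_lhs => rw [eq_smul_one x, map_smul]
      simp
    rw [hadd, h1, map_smul]
    exact W.add_mem (h0 x) (W.smul_mem _ hh)

lemma finrank_linesIn {g : Frame 1 c V} {W : Submodule ℂ V} (hW : (graphPt g 0).1 ≤ W) :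
    finrank ℂ (linesIn g W) + 1 = finrank ℂ W := by
  have h0 : ∀ x, g (x, 0) ∈ W := fun x => hW (mem_graphPt.2 ⟨x, rfl⟩)
  have hadd : ∀ x y, g (x, y) = g (x, 0) + g (0, y) := fun x y => by rw [← map_add]; simp
  let L : ((Fin 1 → ℂ) × linesIn g W) →ₗ[ℂ] V := g.toLinearMap ∘ₗ
    LinearMap.prodMap LinearMap.id (linesIn g W).subtype
  have hL : ∀ q, L q = g (q.1, q.2) := fun q => rfl
  have hinj : Function.Injective L :=
    g.injective.comp (Function.injective_id.prodMap Subtype.val_injective)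
  have hrange : LinearMap.range L = W := by
    ext w
    constructor
    · rintro ⟨q, rfl⟩
      rw [hL, hadd]
      exact W.add_mem (h0 _) q.2.2
    · intro hw
      have hwy : w = g ((g.symm w).1, 0) + g (0, (g.symm w).2) := by
        rw [← hadd, Prod.mk.eta, g.apply_symm_apply]
      have hyW : (g.symm w).2 ∈ linesIn g W := by
        rw [hwy] at hw
        exact (W.add_mem_iff_right (h0 _)).1 hw
      exact ⟨((g.symm w).1, ⟨_, hyW⟩), g.apply_symm_apply w⟩
  have h1 := LinearMap.finrank_range_of_inj hinj
  rw [hrange, finrank_prod, finrank_fin_fun] at h1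
  omega

/-- The linear model of a family of projective subspaces over the base `S`: the tuples of lines in
the given subspaces, with no condition on the parameter in `S`. -/
def linesFamily {ι : Type*} [Fintype ι] {c : ι → ℕ} (W : ∀ i, Submodule ℂ (Fin (c i) → ℂ))
    (S : Type*) [NormedAddCommGroup S] [NormedSpace ℂ S] :
    Submodule ℂ ((∀ i, Hom 1 (c i)) × S) where
  carrier := {x | ∀ i, x.1 i 1 ∈ W i}
  add_mem' h h' i := (W i).add_mem (h i) (h' i)
  zero_mem' i := (W i).zero_mem
  smul_mem' r _ h i := (W i).smul_mem r (h i)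

lemma finrank_linesFamily {ι : Type*} [Fintype ι] {c : ι → ℕ}
    (W : ∀ i, Submodule ℂ (Fin (c i) → ℂ)) (S : Type*) [NormedAddCommGroup S] [NormedSpace ℂ S]
    [FiniteDimensional ℂ S] :
    finrank ℂ (linesFamily W S) = (∑ i, finrank ℂ (W i)) + finrank ℂ S := by
  let e : linesFamily W S ≃ₗ[ℂ] (∀ i, W i) × S :=
    { toFun := fun x => (fun i => ⟨x.1.1 i 1, x.2 i⟩, x.1.2)
      map_add' := fun x y => rfl
      map_smul' := fun r x => rfl
      invFun := fun y => ⟨(fun i =>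
        (ContinuousLinearMap.proj 0 : (Fin 1 → ℂ) →L[ℂ] ℂ).smulRight (y.1 i : Fin (c i) → ℂ), y.2),
        fun i => by simp⟩
      left_inv := fun x => by
        refine Subtype.ext (Prod.ext (funext fun i => ContinuousLinearMap.ext fun v => ?_) rfl)
        change v 0 • x.1.1 i 1 = x.1.1 i v
        rw [← map_smul, ← eq_smul_one]
      right_inv := fun y => by
        refine Prod.ext (funext fun i => Subtype.ext ?_) rfl
        simp }
  rw [e.finrank_eq, finrank_prod, finrank_pi_fintype]

lemma finrank_hom (a c : ℕ) : finrank ℂ (Hom a c) = a * c := by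
  rw [← (LinearMap.toContinuousLinearMap (𝕜 := ℂ) (E := Fin a → ℂ)
    (F' := Fin c → ℂ)).finrank_eq, finrank_linearMap]
  simp

end Linear

namespace Channel

variable {P : Channel}

/-! ### The local structure of the solution variety -/

variable (P) in
/-- The model space of `𝒮`. -/
abbrev OutModel : Type :=
  ((k : P.ΦR) → Hom (P.d k) (finrank ℂ (Fin (P.N k) → ℂ) - P.d k)) ×
    ((l : P.ΦT) → Hom (P.d l) (finrank ℂ (Fin (P.M l) → ℂ) - P.d l))

variable (P) in
/-- The space in which the charts of `ℋ × 𝒮` take their values. -/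
abbrev ModelSpace : Type :=
  ModelProd (ModelPi fun p : P.Φ => Hom 1 (finrank ℂ (P.Mat p) - 1)) (ModelProd
    (ModelPi fun k : P.ΦR => Hom (P.d k) (finrank ℂ (Fin (P.N k) → ℂ) - P.d k))
    (ModelPi fun l : P.ΦT => Hom (P.d l) (finrank ℂ (Fin (P.M l) → ℂ) - P.d l)))

variable (P) in
/-- A choice of one frame for each factor of `ℋ × 𝒮`. -/
structure Frames where
  H : ∀ p, Frame 1 (finrank ℂ (P.Mat p) - 1) (P.Mat p)
  U : ∀ k : P.ΦR, Frame (P.d k) (finrank ℂ (Fin (P.N k) → ℂ) - P.d k) (Fin (P.N k) → ℂ)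
  V : ∀ l : P.ΦT, Frame (P.d l) (finrank ℂ (Fin (P.M l) → ℂ) - P.d l) (Fin (P.M l) → ℂ)

namespace Frames

variable (g : P.Frames)

/-- The product of the affine charts. -/
def prodChart : OpenPartialHomeomorph (P.Inp × P.Out) P.ModelSpace :=
  (OpenPartialHomeomorph.pi fun p => projChart (g.H p)).prod
    ((OpenPartialHomeomorph.pi fun k => grChart (g.U k)).prod
      (OpenPartialHomeomorph.pi fun l => grChart (g.V l)))

lemma prodChart_mem_atlas : g.prodChart ∈ atlas _ (P.Inp × P.Out) :=
  ⟨_, ⟨_, fun p _ => projChart_mem_atlas (g.H p), rfl⟩, _,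
    ⟨_, ⟨_, fun k _ => grChart_mem_atlas (g.U k), rfl⟩, _,
      ⟨_, fun l _ => grChart_mem_atlas (g.V l), rfl⟩, rfl⟩, rfl⟩

lemma mem_prodChart_target (x) : x ∈ g.prodChart.target :=
  ⟨fun p _ => mem_projChart_target (g.H p) _, fun k _ => mem_grChart_target (g.U k) _,
    fun l _ => mem_grChart_target (g.V l) _⟩

lemma prodChart_symm_apply (h X Y) : g.prodChart.symm (h, X, Y) =
    (fun p => (projEquiv _).symm (graphPt (g.H p) (h p)), fun k => graphPt (g.U k) (X k),
      fun l => graphPt (g.V l) (Y l)) :=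
  Prod.ext (funext fun _ => projChart_symm_apply _ _)
    (Prod.ext (funext fun _ => grChart_symm_apply _ _) (funext fun _ => grChart_symm_apply _ _))

/-- The frame for the channel matrices of a link, moving with the decoders and precoders. -/
def moving (p : P.Φ) (s : P.OutModel) : Frame 1 (finrank ℂ (P.Mat p) - 1) (P.Mat p) :=
  movingFrame (g.U (P.rx p)) (g.V (P.tx p)) (g.H p) (s.1 (P.rx p)) (s.2 (P.tx p))

lemma contDiff_proj_rx (p : P.Φ) : ContDiff ℂ ω fun s : P.OutModel => s.1 (P.rx p) :=
  (ContinuousLinearMap.proj (R := ℂ) (φ := fun k : P.ΦR =>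
    Hom (P.d k) (finrank ℂ (Fin (P.N k) → ℂ) - P.d k)) (P.rx p)).contDiff.comp contDiff_fst

lemma contDiff_proj_tx (p : P.Φ) : ContDiff ℂ ω fun s : P.OutModel => s.2 (P.tx p) :=
  (ContinuousLinearMap.proj (R := ℂ) (φ := fun l : P.ΦT =>
    Hom (P.d l) (finrank ℂ (Fin (P.M l) → ℂ) - P.d l)) (P.tx p)).contDiff.comp contDiff_snd

lemma contDiff_chg_moving (p : P.Φ) : ContDiff ℂ ω fun s => chg (g.H p) (g.moving p s) :=
  contDiff_chg_movingFrame _ _ _ (contDiff_proj_rx p) (contDiff_proj_tx p)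

lemma contDiff_chg_moving' (p : P.Φ) : ContDiff ℂ ω fun s => chg (g.moving p s) (g.H p) :=
  contDiff_chg_movingFrame' _ _ _ (contDiff_proj_rx p) (contDiff_proj_tx p)

/-- The change of coordinates that straightens the solution variety. -/
def straightening : OpenPartialHomeomorph
    (((p : P.Φ) → Hom 1 (finrank ℂ (P.Mat p) - 1)) × P.OutModel)
    (((p : P.Φ) → Hom 1 (finrank ℂ (P.Mat p) - 1)) × P.OutModel) :=
  changeFrames (G := fun p _ => g.H p) (G' := g.moving) g.contDiff_chg_moving
    g.contDiff_chg_moving'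

lemma straightening_mem_groupoid : g.straightening ∈ contDiffGroupoid ω P.model := by
  rw [contDiffGroupoid, mem_groupoid_of_pregroupoid]
  exact ⟨(contDiffOn_changeFramesFun g.contDiff_chg_moving).mono fun x hx => hx.1,
    (contDiffOn_changeFramesFun g.contDiff_chg_moving').mono fun x hx => hx.1⟩

/-- A chart of `ℋ × 𝒮` in which the solution variety is linear. -/
def straightChart : OpenPartialHomeomorph (P.Inp × P.Out) P.ModelSpace :=
  g.prodChart.trans g.straightening

lemma straightChart_mem_maximalAtlas :
    g.straightChart ∈ IsManifold.maximalAtlas P.model ω (P.Inp × P.Out) :=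
  trans_mem_maximalAtlas P.model g.prodChart_mem_atlas g.straightening_mem_groupoid

lemma straightChart_symm_apply {h X Y} (hx : (h, X, Y) ∈ g.straightChart.target) :
    g.straightChart.symm (h, X, Y) =
      (fun p => (projEquiv _).symm (graphPt (g.moving p (X, Y)) (h p)),
        fun k => graphPt (g.U k) (X k), fun l => graphPt (g.V l) (Y l)) := by
  have hx : ∀ p, IsUnit (fstT (g.moving p (X, Y)) (g.H p) (h p)) := hx.1
  refine (g.prodChart_symm_apply _ X Y).trans (Prod.ext (funext fun p => ?_) rfl)
  exact congrArg (projEquiv (P.Mat p)).symm (graphPt_transit (hx p))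

variable (P) in
/-- The value of a product chart at its centre. -/
def origin : P.ModelSpace :=
  (fun _ => (0 : Hom _ _), fun _ => (0 : Hom _ _), fun _ => (0 : Hom _ _))

/-- The point of `ℋ × 𝒮` at which all the affine charts are centred. -/
def center : P.Inp × P.Out :=
  (fun p => (projEquiv _).symm (graphPt (g.H p) 0), fun k => graphPt (g.U k) 0,
    fun l => graphPt (g.V l) 0)

lemma prodChart_symm_origin : g.prodChart.symm (origin P) = g.center :=
  g.prodChart_symm_apply _ _ _

lemma exists_center_eq (z : P.Inp × P.Out) : ∃ g : P.Frames, g.center = z := by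
  choose gH hH using fun p => exists_frame_graphPt_zero (projEquiv _ (z.1 p))
  choose gU hU using fun k => exists_frame_graphPt_zero (z.2.1 k)
  choose gV hV using fun l => exists_frame_graphPt_zero (z.2.2 l)
  exact ⟨⟨gH, gU, gV⟩, Prod.ext (funext fun p => (Equiv.symm_apply_eq _).2 (hH p))
    (Prod.ext (funext hU) (funext hV))⟩

lemma center_mem_source : g.center ∈ g.straightChart.source := by
  have h0 := g.mem_prodChart_target (origin P)
  rw [← prodChart_symm_origin]
  refine ⟨g.prodChart.map_target h0, ?_⟩
  change g.prodChart (g.prodChart.symm (origin P)) ∈ g.straightening.source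
  rw [g.prodChart.right_inv h0]
  intro p
  change IsUnit (fstT (g.H p) (movingFrame (g.U (P.rx p)) (g.V (P.tx p)) (g.H p) 0 0) 0)
  rw [movingFrame_zero]
  exact isUnit_fstT_self _ _

lemma center_mem_iff : g.center ∈ P.solutionVariety ↔
    ∀ p, (graphPt (g.H p) 0).1 ≤
      annih (graphPt (g.U (P.rx p)) 0).1 (graphPt (g.V (P.tx p)) 0).1 := by
  rw [mem_solutionVariety_iff]
  refine forall_congr' fun p => ?_
  rw [center, Equiv.apply_symm_apply]

/-- The linear space of which the solution variety is a piece in the straightening chart. -/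
def tangent : Submodule ℂ (((p : P.Φ) → Hom 1 (finrank ℂ (P.Mat p) - 1)) × P.OutModel) :=
  linesFamily (fun p => linesIn (g.H p)
    (annih (graphPt (g.U (P.rx p)) 0).1 (graphPt (g.V (P.tx p)) 0).1)) _

/-- In the straightening chart, membership in the solution variety is the condition that the lines
of channel matrices annihilate the central pairs of subspaces. -/
lemma straightChart_symm_mem_iff (hg : g.center ∈ P.solutionVariety)
    (x) (hx : x ∈ g.straightChart.target) :
    g.straightChart.symm x ∈ P.solutionVariety ↔ P.model x ∈ g.tangent := by
  obtain ⟨h, X, Y⟩ := x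
  rw [mem_solutionVariety_iff, g.straightChart_symm_apply hx]
  refine forall_congr' fun p => ?_
  rw [Equiv.apply_symm_apply]
  refine Iff.trans ?_ (graphPt_le_iff (g.center_mem_iff.1 hg p))
  have key : ∀ v, g.moving p (X, Y) v ∈ annih (graphPt (g.U (P.rx p)) (X (P.rx p))).1
      (graphPt (g.V (P.tx p)) (Y (P.tx p))).1 ↔ g.H p v ∈
      annih (graphPt (g.U (P.rx p)) 0).1 (graphPt (g.V (P.tx p)) 0).1 := by
    intro v
    rw [← pullback_mem_annih]
    have : pullback (g.U (P.rx p)) (g.V (P.tx p)) (X (P.rx p)) (Y (P.tx p))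
        (g.moving p (X, Y) v) = g.H p v := LinearEquiv.apply_symm_apply _ _
    rw [this]
  constructor
  · rintro hle _ hv
    obtain ⟨v, rfl⟩ := mem_graphPt.1 hv
    exact (key _).1 (hle (mem_graphPt.2 ⟨v, rfl⟩))
  · rintro hle _ hv
    obtain ⟨v, rfl⟩ := mem_graphPt.1 hv
    exact (key _).2 (hle (mem_graphPt.2 ⟨v, rfl⟩))

end Frames

variable (P) in
/-- The complex dimension of `𝒮`. -/
def dimOut : ℕ := (∑ k : P.ΦR, P.d k * (P.N k - P.d k)) + ∑ l : P.ΦT, P.d l * (P.M l - P.d l)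

lemma finrank_outModel : finrank ℂ P.OutModel = P.dimOut := by
  rw [finrank_prod, finrank_pi_fintype, finrank_pi_fintype]
  simp only [finrank_hom, finrank_fin_fun]
  rfl

variable (P) in
/-- The complex dimension of the solution variety: that of `𝒮` plus that of the fibres, which are
products of projective spaces. -/
def dimSolution : ℕ :=
  (∑ p : P.Φ, (P.N (P.rx p) * P.M (P.tx p) - P.d (P.rx p) * P.d (P.tx p) - 1)) + P.dimOut

lemma Frames.finrank_tangent (g : P.Frames) (hg : g.center ∈ P.solutionVariety) :
    finrank ℂ g.tangent = P.dimSolution := by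
  rw [Frames.tangent, finrank_linesFamily, finrank_outModel, dimSolution]
  congr 1
  refine Finset.sum_congr rfl fun p _ => ?_
  have h1 := finrank_linesIn (g.center_mem_iff.1 hg p)
  have h2 := finrank_annih (graphPt (g.U (P.rx p)) 0) (graphPt (g.V (P.tx p)) 0)
  exact Nat.eq_sub_of_add_eq (h1.trans (Nat.eq_sub_of_add_eq h2))

theorem isComplexSubmanifold_solutionVariety :
    IsComplexSubmanifold P.model P.dimSolution P.solutionVariety := by
  intro z hz
  obtain ⟨g, rfl⟩ := Frames.exists_center_eq z
  exact ⟨g.straightChart, g.straightChart_mem_maximalAtlas, g.center_mem_source, g.tangent,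
    g.finrank_tangent hz, extend_image_eq P.model _ _ _ (g.straightChart_symm_mem_iff hz)⟩

/-! ### Dimension count -/

lemma dimInp_eq : P.dimInp = ∑ p : P.Φ, (P.N (P.rx p) * P.M (P.tx p) - 1) := by
  rw [dimInp, finrank_pi_fintype]
  simp [finrank_hom, finrank_matrix]

lemma dimOut_cast (hR : ∀ k ∈ P.ΦR, P.d k ≤ P.N k) (hT : ∀ l ∈ P.ΦT, P.d l ≤ P.M l) :
    (P.dimOut : ℤ) = (∑ k ∈ P.ΦR, ((P.N k : ℤ) * P.d k - (P.d k : ℤ) ^ 2))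
      + ∑ l ∈ P.ΦT, ((P.M l : ℤ) * P.d l - (P.d l : ℤ) ^ 2) := by
  rw [dimOut, ← Finset.sum_coe_sort P.ΦR, ← Finset.sum_coe_sort P.ΦT]
  push_cast
  congr 1
  · refine Finset.sum_congr rfl fun k _ => ?_
    rw [Nat.cast_sub (hR k k.2)]
    ring
  · refine Finset.sum_congr rfl fun l _ => ?_
    rw [Nat.cast_sub (hT l l.2)]
    ring

end Channel

end IA

end

theorem mainTheorem6 (P : IA.Channel) (hΦ : P.Φ.Nonempty)
    (hR : ∀ k ∈ P.ΦR, 1 ≤ P.d k ∧ P.d k ≤ P.N k)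
    (hT : ∀ l ∈ P.ΦT, 1 ≤ P.d l ∧ P.d l ≤ P.M l)
    (hd : ∀ p ∈ P.Φ, P.d p.1 + P.d p.2 < P.N p.1 + P.M p.2) :
    P.solutionVariety.Nonempty ∧ IsCompact P.solutionVariety ∧
      P.IsAlgebraicSubvariety P.solutionVariety ∧
      ∃ n : ℕ, IA.IsComplexSubmanifold P.model n P.solutionVariety ∧
        (n : ℤ) = (∑ p ∈ P.Φ, ((P.N p.1 : ℤ) * P.M p.2 - (P.d p.1 : ℤ) * P.d p.2))
          + (∑ k ∈ P.ΦR, ((P.N k : ℤ) * P.d k - (P.d k : ℤ) ^ 2))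
          + (∑ l ∈ P.ΦT, ((P.M l : ℤ) * P.d l - (P.d l : ℤ) ^ 2))
          - (P.Φ.card : ℤ) ∧
        P.s = (n : ℤ) - (P.dimInp : ℤ) := by
  have hlt := IA.Channel.mul_lt_mul_of_mem hR hT hd
  have hn : (P.dimSolution : ℤ) =
      (∑ p ∈ P.Φ, ((P.N p.1 : ℤ) * P.M p.2 - (P.d p.1 : ℤ) * P.d p.2))
        - (P.Φ.card : ℤ) + P.dimOut := by
    rw [IA.Channel.dimSolution, ← Finset.sum_coe_sort P.Φ, Nat.cast_add, Nat.cast_sum,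
      Finset.card_eq_sum_ones, ← Finset.sum_coe_sort P.Φ (fun _ => 1), Nat.cast_sum,
      ← Finset.sum_sub_distrib]
    congr 1
    refine Finset.sum_congr rfl fun p _ => ?_
    rw [Nat.cast_sub (by have := hlt p; omega), Nat.cast_sub (by have := hlt p; omega)]
    push_cast
    rfl
  have hi : (P.dimInp : ℤ) = (∑ p ∈ P.Φ, (P.N p.1 : ℤ) * P.M p.2) - (P.Φ.card : ℤ) := by
    rw [IA.Channel.dimInp_eq, ← Finset.sum_coe_sort P.Φ, Nat.cast_sum,
      Finset.card_eq_sum_ones, ← Finset.sum_coe_sort P.Φ (fun _ => 1), Nat.cast_sum,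
      ← Finset.sum_sub_distrib]
    refine Finset.sum_congr rfl fun p _ => ?_
    rw [Nat.cast_sub (by have := hlt p; omega)]
    push_cast
    rfl
  have ho := P.dimOut_cast (fun k hk => (hR k hk).2) (fun l hl => (hT l hl).2)
  refine ⟨P.solutionVariety_nonempty hR hT hd, P.isCompact_solutionVariety,
    P.isAlgebraicSubvariety_solutionVariety, P.dimSolution,
    P.isComplexSubmanifold_solutionVariety, ?_, ?_⟩
  · rw [hn, ho]
    ring
  · have hsub := Finset.sum_sub_distrib (s := P.Φ) (fun p => (P.N p.1 : ℤ) * P.M p.2)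
      fun p => (P.d p.1 : ℤ) * P.d p.2
    rw [hn, hi, ho, IA.Channel.s, hsub]
    ring
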